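/- **Cascading hybrid bandit.** Let $1\le K\le L$, $\mathcal D=[L]$, and let each item $a$ have a topic-coverage vector $x_a\in[0,1]^d$ and a relevance feature $z_a\in\mathbb R^m$ with $\|z_a\|\le 1$. For $S\subseteq\mathcal D$ put $g_j(S)=1-\prod_{a\in S}(1-x_a(j))$ and $\Delta(a\mid S)=\big(g_j(S\cup\{a\})-g_j(S)\big)_{j\le d}$. Let $\theta^*\in\mathbb R^d$, $\beta^*\in\mathbb R^m$, $w^*=(\theta^*,\beta^*)$, $\|w^*\|\le1$ (Euclidean norms). The attraction probability of $a$ ranked below exactly the items of $S$ is $\alpha(a\mid S)=z_a^T\beta^*+\Delta(a\mid S)^T\theta^*$; assume that it lies in $[0,1]$ for all $S$ and $a\notin S$, and that the coverage utility $S\mapsto\sum_j\theta^*_j g_j(S)$ is submodular (as is the case when $\theta^*\ge0$). At step $t$ the agent displays a list $R_t=(R_t(1),\dots,R_t(K))$ of distinct items. Given the past and $R_t$, the attraction indicators $A_t(R_t(k))\in\{0,1\}$ are independent Bernoulli with means $\alpha(R_t(k)\mid\{R_t(1),\dots,R_t(k-1)\})$; the agent observes the position $c_t$ of the first attractive item ($c_t=K+1$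 if there is none), and the reward is $r(R_t,A_t)=1-\prod_k(1-A_t(R_t(k)))$. Write $r(R)=1-\prod_k\big(1-\alpha(R(k)\mid\{R(1),\dots,R(k-1)\})\big)$. **Algorithm CascadeHybrid** with parameter $\gamma$. Start with $H=I_d$, $u=0$, $M=I_m$, $y=0$, $B=0_{d\times m}$. At each step put $\hat\theta=H^{-1}u$, $\hat\beta=M^{-1}(y-B^TH^{-1}u)$ and build $R_t$ greedily: position $k$ receives an item $a$ not in $S=\{R_t(1),\dots,R_t(k-1)\}$ which maximizes (ties broken arbitrarily), with $\omega_a=\Delta(a\mid S)$, $$\omega_a^T\hat\theta+z_a^T\hat\beta+\gamma\sqrt{s_a},\qquad s_a=\omega_a^TH^{-1}\omega_a-2\omega_a^TH^{-1}BM^{-1}z_a+z_a^TM^{-1}z_a+z_a^TM^{-1}B^TH^{-1}BM^{-1}z_a .$$ After the feedback, replace $H\leftarrow H+BM^{-1}B^T$ and $u\leftarrow u+BM^{-1}y$; for each of the first $\min(K,c_t)$ items $a$ of $R_t$, with its gain $\omega_a$, add $z_az_a^T$ to $M$, $\omega_az_a^T$ to $B$ and $\omega_a\omega_a^T$ to $H$;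 if $c_t\le K$ and $a=R_t(c_t)$, add $z_a$ to $y$ and $\omega_a$ to $u$; finally, with the new $B,M,y$, replace $H\leftarrow H-BM^{-1}B^T$ and $u\leftarrow u-BM^{-1}y$. **Theorem.** Let $\eta=(1-\tfrac1e)\max\{\tfrac1K,\,1-\tfrac{K-1}2\alpha_{\max}\}$ with $\alpha_{\max}=\max_a(z_a^T\beta^*+x_a^T\theta^*)$, and let $$R_\eta(n)=\sum_{t=1}^n\mathbb E\big[\eta\max_R r(R)-r(R_t,A_t)\big]$$ be the $\eta$-scaled $n$-step regret of CascadeHybrid. If $$\gamma\ \ge\ \gamma_0:=\sqrt{(m+d)\log\Big(1+\frac{nK}{m+d}\Big)+2\log n}+\|w^*\|,$$ then $$R_\eta(n)\ \le\ 2\gamma\sqrt{2nK(m+d)\log\Big(1+\frac{nK}{m+d}\Big)}+1 .$$ In particular $R_\eta(n)=\tilde O\big((m+d)\sqrt{Kn}\big)$ for $\gamma=\gamma_0$: there is a universal constant $C$ with $R_\eta(n)\le C\,(m+d)\sqrt{Kn}\,\log(1+nK)$. -/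

import Mathlib

open MeasureTheory Matrix

noncomputable section

namespace CascadeHybrid

/-! ## Topic coverage and the attraction model

Items are the elements of `Fin L`; item `a` has topic coverage vector `x a : Fin d → ℝ` and
relevance feature vector `z a : Fin m → ℝ`.  A ranked list of `K` distinct items is an
embedding `Fin K ↪ Fin L` (positions are numbered from `0`). -/

/-- Probability that the set of items `S` covers topic `j`. -/
def coverage {L d : ℕ} (x : Fin L → Fin d → ℝ) (S : Finset (Fin L)) (j : Fin d) : ℝ :=
  1 - ∏ a ∈ S, (1 - x a j)

/-- Gain in topic coverage of adding item `a` to `S`, a vector indexed by the topics. -/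
def gain {L d : ℕ} (x : Fin L → Fin d → ℝ) (S : Finset (Fin L)) (a : Fin L) : Fin d → ℝ :=
  fun j => coverage x (insert a S) j - coverage x S j

/-- Submodularity (diminishing gains) of a real-valued set function. -/
def IsSubmodular {ι : Type*} [DecidableEq ι] (g : Finset ι → ℝ) : Prop :=
  ∀ A B : Finset ι, B ⊆ A → ∀ a, a ∉ A → g (insert a A) - g A ≤ g (insert a B) - g B

/-- Attraction probability of item `a` when the items ranked above it are those of `S`. -/
def attraction {L m d : ℕ} (x : Fin L → Fin d → ℝ) (z : Fin L → Fin m → ℝ)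
    (θ : Fin d → ℝ) (β : Fin m → ℝ) (S : Finset (Fin L)) (a : Fin L) : ℝ :=
  z a ⬝ᵥ β + gain x S a ⬝ᵥ θ

/-- The set of items that the list `R` ranks strictly above position `k`. -/
def above {L K : ℕ} (R : Fin K ↪ Fin L) (k : Fin K) : Finset (Fin L) :=
  (Finset.Iio k).map R

/-- Expected number of clicks `r(R)` on the list `R`. -/
def expectedReward {L K m d : ℕ} (x : Fin L → Fin d → ℝ) (z : Fin L → Fin m → ℝ)
    (θ : Fin d → ℝ) (β : Fin m → ℝ) (R : Fin K ↪ Fin L) : ℝ :=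
  1 - ∏ k, (1 - attraction x z θ β (above R k) (R k))

/-- Expected number of clicks on an optimal list, `max_R r(R)`. -/
def optimalReward {L m d : ℕ} (K : ℕ) (x : Fin L → Fin d → ℝ) (z : Fin L → Fin m → ℝ)
    (θ : Fin d → ℝ) (β : Fin m → ℝ) : ℝ :=
  ⨆ R : Fin K ↪ Fin L, expectedReward x z θ β R

/-- `α_max = max_a (z_aᵀ β + x_aᵀ θ)`. -/
def alphaMax {L m d : ℕ} (x : Fin L → Fin d → ℝ) (z : Fin L → Fin m → ℝ)
    (θ : Fin d → ℝ) (β : Fin m → ℝ) : ℝ :=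
  ⨆ a : Fin L, (z a ⬝ᵥ β + x a ⬝ᵥ θ)

/-- The approximation ratio `η = (1 - 1/e) max {1/K, 1 - (K-1)/2 * α_max}`. -/
def eta {L m d : ℕ} (K : ℕ) (x : Fin L → Fin d → ℝ) (z : Fin L → Fin m → ℝ)
    (θ : Fin d → ℝ) (β : Fin m → ℝ) : ℝ :=
  (1 - 1 / Real.exp 1) * max (1 / (K : ℝ)) (1 - ((K : ℝ) - 1) / 2 * alphaMax x z θ β)

/-- Realized number of clicks `r(R, A)` on `R`, for attraction indicators `A`. -/
def reward {L K : ℕ} (R : Fin K ↪ Fin L) (A : Fin L → Bool) : ℝ :=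
  1 - ∏ k, (1 - if A (R k) = true then (1 : ℝ) else 0)

/-- Position of the click on `R` (the first attractive item), and `K` if there is no click. -/
def click {L K : ℕ} (R : Fin K ↪ Fin L) (A : Fin L → Bool) : ℕ :=
  (List.ofFn fun k => A (R k)).findIdx id

/-! ## The algorithm -/

/-- The statistics kept by the algorithm. -/
structure Stats (m d : ℕ) where
  M : Matrix (Fin m) (Fin m) ℝ
  B : Matrix (Fin d) (Fin m) ℝ
  H : Matrix (Fin d) (Fin d) ℝ
  y : Fin m → ℝ
  u : Fin d → ℝ

namespace Stats

/-- Initial statistics. -/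
def init (m d : ℕ) : Stats m d where
  M := 1
  B := 0
  H := 1
  y := 0
  u := 0

/-- Estimate of `θ`. -/
def thetaHat {m d : ℕ} (s : Stats m d) : Fin d → ℝ :=
  s.H⁻¹ *ᵥ s.u

/-- Estimate of `β`. -/
def betaHat {m d : ℕ} (s : Stats m d) : Fin m → ℝ :=
  s.M⁻¹ *ᵥ (s.y - s.Bᵀ *ᵥ (s.H⁻¹ *ᵥ s.u))

/-- Squared confidence width of an item with coverage gain `ω` and relevance feature `ζ`. -/
def width {m d : ℕ} (s : Stats m d) (ω : Fin d → ℝ) (ζ : Fin m → ℝ) : ℝ :=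
  ω ⬝ᵥ (s.H⁻¹ *ᵥ ω) - 2 * (ω ⬝ᵥ ((s.H⁻¹ * s.B * s.M⁻¹) *ᵥ ζ)) + ζ ⬝ᵥ (s.M⁻¹ *ᵥ ζ)
    + ζ ⬝ᵥ ((s.M⁻¹ * s.Bᵀ * s.H⁻¹ * s.B * s.M⁻¹) *ᵥ ζ)

/-- Upper confidence bound of an item with coverage gain `ω` and relevance feature `ζ`. -/
def ucb {m d : ℕ} (s : Stats m d) (γ : ℝ) (ω : Fin d → ℝ) (ζ : Fin m → ℝ) : ℝ :=
  ω ⬝ᵥ s.thetaHat + ζ ⬝ᵥ s.betaHat + γ * √(s.width ω ζ)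

/-- Update of the statistics after displaying `R` and observing a click at position `c`
(no click if `c = K`); the observed positions are those `k` with `k ≤ c`. -/
def update {L K m d : ℕ} (x : Fin L → Fin d → ℝ) (z : Fin L → Fin m → ℝ)
    (s : Stats m d) (R : Fin K ↪ Fin L) (c : ℕ) : Stats m d :=
  let ω : Fin K → Fin d → ℝ := fun k => gain x (above R k) (R k)
  let obs : Finset (Fin K) := Finset.univ.filter fun k => (k : ℕ) ≤ c
  let M' := s.M + ∑ k ∈ obs, vecMulVec (z (R k)) (z (R k))
  let B' := s.B + ∑ k ∈ obs, vecMulVec (ω k) (z (R k))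
  let H' := s.H + s.B * s.M⁻¹ * s.Bᵀ + ∑ k ∈ obs, vecMulVec (ω k) (ω k)
  let y' := s.y + if h : c < K then z (R ⟨c, h⟩) else 0
  let u' := s.u + (s.B * s.M⁻¹) *ᵥ s.y + if h : c < K then ω ⟨c, h⟩ else 0
  { M := M'
    B := B'
    H := H' - B' * M'⁻¹ * B'ᵀ
    y := y'
    u := u' - (B' * M'⁻¹) *ᵥ y' }

/-- Statistics before step `t`, when the lists `R 0, R 1, …` were displayed and the clicks
`c 0, c 1, …` were observed. -/
def atTime {L K m d : ℕ} (x : Fin L → Fin d → ℝ) (z : Fin L → Fin m → ℝ)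
    (R : ℕ → Fin K ↪ Fin L) (c : ℕ → ℕ) : ℕ → Stats m d
  | 0 => init m d
  | t + 1 => update x z (atTime x z R c t) (R t) (c t)

/-- `R` is a list that the algorithm may display when its statistics are `s`: each position
is filled with a maximizer of the upper confidence bound among the items not ranked above
(ties are broken arbitrarily). -/
def IsChoice {L K m d : ℕ} (x : Fin L → Fin d → ℝ) (z : Fin L → Fin m → ℝ)
    (γ : ℝ) (s : Stats m d) (R : Fin K ↪ Fin L) : Prop :=
  ∀ k, ∀ a, a ∉ above R k →
    s.ucb γ (gain x (above R k) a) (z a) ≤ s.ucb γ (gain x (above R k) (R k)) (z (R k))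

end Stats

/-! ## The interaction of the algorithm with the user -/

/-- `R t` (displayed list) and `A t` (attraction indicators), `t < n`, form an `n`-step run of
the algorithm with parameter `γ` on the cascading hybrid bandit with parameters `θ`, `β`.
The σ-algebra `ℱ t` is the information available when step `t` starts, the list `R t`
included; given it, the items of `R t` are attractive independently of each other, each with
its attraction probability. -/
structure IsRun {L K m d : ℕ} (x : Fin L → Fin d → ℝ) (z : Fin L → Fin m → ℝ)
    (θ : Fin d → ℝ) (β : Fin m → ℝ) (γ : ℝ) (n : ℕ)
    {Ω : Type*} [mΩ : MeasurableSpace Ω] (μ : Measure Ω) (ℱ : Filtration ℕ mΩ)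
    (R : ℕ → Ω → Fin K ↪ Fin L) (A : ℕ → Ω → Fin L → Bool) : Prop where
  measurable_list : ∀ t < n, ∀ k, Measurable[ℱ t] fun ω => R t ω k
  measurable_attraction : ∀ t < n, ∀ a, Measurable[ℱ (t + 1)] fun ω => A t ω a
  choice : ∀ t < n, ∀ ω, Stats.IsChoice x z γ
    (Stats.atTime x z (fun s => R s ω) (fun s => click (R s ω) (A s ω)) t) (R t ω)
  law : ∀ t < n, ∀ b : Fin K → Bool,
    μ[Set.indicator {ω | ∀ k, A t ω (R t ω k) = b k} (fun _ => (1 : ℝ)) | ℱ t] =ᵐ[μ]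
      fun ω => ∏ k, if b k = true
        then attraction x z θ β (above (R t ω) k) (R t ω k)
        else 1 - attraction x z θ β (above (R t ω) k) (R t ω k)

/-- The `η`-scaled expected `n`-step regret. -/
def scaledRegret {L K m d : ℕ} (x : Fin L → Fin d → ℝ) (z : Fin L → Fin m → ℝ)
    (θ : Fin d → ℝ) (β : Fin m → ℝ) (n : ℕ)
    {Ω : Type*} [MeasurableSpace Ω] (μ : Measure Ω)
    (R : ℕ → Ω → Fin K ↪ Fin L) (A : ℕ → Ω → Fin L → Bool) : ℝ :=
  ∑ t ∈ Finset.range n,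
    ∫ ω, (eta K x z θ β * optimalReward K x z θ β - reward (R t ω) (A t ω)) ∂μ

/-- Euclidean norm of the stacked parameter vector `w = (θ, β)`. -/
def paramNorm {m d : ℕ} (θ : Fin d → ℝ) (β : Fin m → ℝ) : ℝ :=
  ‖(WithLp.toLp 2 (Sum.elim θ β) : EuclideanSpace ℝ (Fin d ⊕ Fin m))‖

/-- The smallest exploration parameter that the regret bound admits. -/
def gammaMin {m d : ℕ} (K n : ℕ) (θ : Fin d → ℝ) (β : Fin m → ℝ) : ℝ :=
  √(((m : ℝ) + d) * Real.log (1 + (n : ℝ) * K / ((m : ℝ) + d)) + 2 * Real.log n)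
    + paramNorm θ β

end CascadeHybrid

end

/-! # Regret of the cascading hybrid bandit

Write `φ` for the stacked feature (coverage gain, relevance feature) of an item and `w = (θ, β)`.
The statistics are a ridge regression in disguise: `H` is the Schur complement of the block `M` in
the Gram matrix `V = 1 + ∑ φ φᵀ` of the observed features, the two estimates are the blocks of the
ridge estimator, and the width is `φᵀ V⁻¹ φ` (`Stats.gram_inv`, `Stats.width_eq`,
`Stats.estimate_eq`).

*Confidence.* The attraction indicators are sub-Gaussian with variance proxy `1 / 4`, and stopping
at the click preserves the exponential supermartingale. Mixing over Gaussian directions bounds the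
self-normalized noise by `log (det V) / 4 + log n / 2` outside an event of probability `1 / n`, at
each fixed step (`IsRun.measureReal_not_confident_le`). As the regret of a step only depends on
the confidence event of that step, the exceptional events contribute at most `1` in total.

*One step.* Replace the attraction probability `p k` at each position of the displayed list by the
best one `q k` that was available there. Submodularity and the greedy recursion give
`eta * optimalReward ≤ 1 - ∏ (1 - q k)`, so the regret is at most `∏ (1 - p k) - ∏ (1 - q k)`. This
difference is at most the expected sum, over the observed positions only, of any upper bounds on
`q k - p k`, and that sum may be truncated at `1` (`prod_sub_prod_le_sum_patternProb`,
`eta_mul_optimalReward_sub_le`). On the confidence event `2 γ` times the square root of the width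
is such a bound.

*Potential.* If `S` is the sum of the observed squared widths of a step, then `det V` grows at
least by the factor `1 + S` in that step (`det_mul_one_add_sum_le`), and the truncation allows
to replace `S` by nearly `log (1 + S)`; the Cauchy-Schwarz inequality finishes the estimate
(`sum_min_one_le`).

The feature vectors may have norm larger than `1`: the gains of a list only satisfy
`∑ ‖φ‖ ^ 2 ≤ K + d`, which gives `log (det V) ≤ D log (1 + n K / D + n)` with `D = m + d`. This
suffices because the regret is trivially at most `n`: where the claimed bound is smaller than `n`,
the horizon exceeds a multiple of `D ^ 2 * K`, and then `D log (1 + n K / D + n)` is at most twice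
`D log (1 + n K / D)` with room for the constant of the potential
(`log_det_bound_of_nontrivial`).
-/

namespace CascadeHybrid

/-! ### Positive definite matrices: weighted norms, determinants and Gaussian integrals -/

section LinearAlgebra

variable {ι : Type*} [Fintype ι] [DecidableEq ι]

open scoped MatrixOrder in
theorem exists_transpose_mul_self_of_posDef {V : Matrix ι ι ℝ} (hV : V.PosDef) :
    ∃ A : Matrix ι ι ℝ, V = Aᵀ * A ∧ A.det ≠ 0 ∧ V.det = A.det ^ 2 := by
  obtain ⟨A, hA⟩ := CStarAlgebra.nonneg_iff_eq_star_mul_self.mp hV.posSemidef.nonneg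
  rw [star_eq_conjTranspose, conjTranspose_eq_transpose_of_trivial] at hA
  have hdet : V.det = A.det ^ 2 := by rw [hA, det_mul, det_transpose, sq]
  refine ⟨A, hA, fun h => ?_, hdet⟩
  have := hV.det_pos
  rw [hdet, h] at this
  simp at this

theorem dotProduct_inv_mulVec_eq {V A : Matrix ι ι ℝ} (hVA : V = Aᵀ * A) (x y : ι → ℝ) :
    x ⬝ᵥ (V⁻¹ *ᵥ y) = (A⁻¹ᵀ *ᵥ x) ⬝ᵥ (A⁻¹ᵀ *ᵥ y) := by
  rw [hVA, Matrix.mul_inv_rev, ← transpose_nonsing_inv, ← mulVec_mulVec, dotProduct_mulVec,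
    ← mulVec_transpose]

theorem abs_dotProduct_inv_mulVec_le {V : Matrix ι ι ℝ} (hV : V.PosDef) (x y : ι → ℝ) :
    |x ⬝ᵥ (V⁻¹ *ᵥ y)| ≤ √(x ⬝ᵥ (V⁻¹ *ᵥ x)) * √(y ⬝ᵥ (V⁻¹ *ᵥ y)) := by
  obtain ⟨A, hA, -, -⟩ := exists_transpose_mul_self_of_posDef hV
  simp only [dotProduct_inv_mulVec_eq hA]
  generalize A⁻¹ᵀ *ᵥ x = a
  generalize A⁻¹ᵀ *ᵥ y = b
  have ha : 0 ≤ a ⬝ᵥ a := Finset.sum_nonneg fun i _ => mul_self_nonneg (a i)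
  rw [← Real.sqrt_mul ha]
  apply Real.abs_le_sqrt
  simp only [dotProduct]
  simpa only [sq] using Finset.sum_mul_sq_le_sq_mul_sq Finset.univ a b

theorem dotProduct_inv_mulVec_nonneg {V : Matrix ι ι ℝ} (hV : V.PosDef) (x : ι → ℝ) :
    0 ≤ x ⬝ᵥ (V⁻¹ *ᵥ x) := by
  simpa using hV.inv.posSemidef.dotProduct_mulVec_nonneg x

/-- A regularized Gram matrix dominates the identity, so its inverse shrinks the norm. -/
theorem sqrt_dotProduct_inv_mulVec_le {P : Matrix ι ι ℝ} (hP : P.PosSemidef) (w : ι → ℝ) :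
    √(w ⬝ᵥ ((1 + P)⁻¹ *ᵥ w)) ≤ √(w ⬝ᵥ w) := by
  have hV : (1 + P).PosDef := PosDef.one.add_posSemidef hP
  set V := 1 + P
  set v := V⁻¹ *ᵥ w with hv
  have hw : w = V *ᵥ v := by
    rw [hv, mulVec_mulVec,
      Matrix.mul_nonsing_inv _ ((isUnit_iff_isUnit_det V).1 hV.isUnit), one_mulVec]
  have h1 : v ⬝ᵥ v ≤ w ⬝ᵥ v := by
    have h := hP.dotProduct_mulVec_nonneg v
    rw [dotProduct_comm w v, hw, show V *ᵥ v = v + P *ᵥ v by rw [add_mulVec, one_mulVec],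
      dotProduct_add]
    simp only [star_trivial] at h
    linarith
  have h2 : (w ⬝ᵥ v) ^ 2 ≤ (w ⬝ᵥ w) * (v ⬝ᵥ v) := by
    simp only [dotProduct]
    simpa only [sq] using Finset.sum_mul_sq_le_sq_mul_sq Finset.univ w v
  have h0 : 0 ≤ v ⬝ᵥ v := Finset.sum_nonneg fun i _ => mul_self_nonneg (v i)
  have hw0 : 0 ≤ w ⬝ᵥ w := Finset.sum_nonneg fun i _ => mul_self_nonneg (w i)
  apply Real.sqrt_le_sqrt
  by_contra! hlt
  nlinarith

theorem one_add_sum_le_prod {κ : Type*} (s : Finset κ) (f : κ → ℝ) (hf : ∀ i ∈ s, 0 ≤ f i) :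
    1 + ∑ i ∈ s, f i ≤ ∏ i ∈ s, (1 + f i) := by
  classical
  induction s using Finset.induction_on with
  | empty => simp
  | insert a s ha ih =>
    rw [Finset.sum_insert ha, Finset.prod_insert ha]
    have h1 := ih fun i hi => hf i (Finset.mem_insert_of_mem hi)
    have h2 := hf a (Finset.mem_insert_self a s)
    have h3 : 0 ≤ ∑ i ∈ s, f i := Finset.sum_nonneg fun i hi => hf i (Finset.mem_insert_of_mem hi)
    nlinarith

theorem one_add_trace_le_det_one_add {P : Matrix ι ι ℝ} (hP : P.PosSemidef) :
    1 + P.trace ≤ (1 + P).det := by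
  have hdet : (1 + P).det = ∏ i, (1 + hP.1.eigenvalues i) := by
    -- Evaluate the characteristic polynomial, a product over the eigenvalues, at `-1`.
    have h := congrArg (Polynomial.eval (-1)) hP.1.charpoly_eq
    rw [Matrix.eval_charpoly, Polynomial.eval_prod] at h
    have h2 : (1 + P).det = (-1) ^ Fintype.card ι * (Matrix.scalar ι (-1 : ℝ) - P).det := by
      rw [← det_neg]
      congr 1
      ext i j
      simp [Matrix.one_apply, Matrix.diagonal_apply]
      split_ifs <;> ring
    rw [h2, h, ← Finset.card_univ, ← Finset.prod_const, ← Finset.prod_mul_distrib]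
    refine Finset.prod_congr rfl fun i _ => ?_
    simp
    ring
  rw [hdet, hP.1.trace_eq_sum_eigenvalues]
  exact one_add_sum_le_prod _ _ fun i _ => hP.eigenvalues_nonneg i

theorem posSemidef_sum_vecMulVec {ι κ : Type*} [Fintype ι] (s : Finset κ) (φ : κ → ι → ℝ) :
    (∑ k ∈ s, vecMulVec (φ k) (φ k)).PosSemidef :=
  posSemidef_sum s fun k _ => by simpa using posSemidef_vecMulVec_self_star (φ k)

/-- The matrix determinant lemma for a batch of updates, as an inequality: the determinant grows
at least by the factor `1 + ∑ₖ φₖᵀ V⁻¹ φₖ`. -/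
theorem det_mul_one_add_sum_le {V : Matrix ι ι ℝ} (hV : V.PosDef) {κ : Type*} (s : Finset κ)
    (φ : κ → ι → ℝ) :
    V.det * (1 + ∑ k ∈ s, φ k ⬝ᵥ (V⁻¹ *ᵥ φ k)) ≤
      (V + ∑ k ∈ s, vecMulVec (φ k) (φ k)).det := by
  obtain ⟨A, hA, hA0, hdet⟩ := exists_transpose_mul_self_of_posDef hV
  set ψ : κ → ι → ℝ := fun k => A⁻¹ᵀ *ᵥ φ k with hψ
  have hu : IsUnit A.det := isUnit_iff_ne_zero.2 hA0
  have hut : IsUnit Aᵀ.det := by rwa [det_transpose]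
  have hφ : ∀ k, vecMulVec (φ k) (φ k) = Aᵀ * vecMulVec (ψ k) (ψ k) * A := by
    intro k
    have h1 : Aᵀ *ᵥ ψ k = φ k := by
      rw [hψ]
      simp only
      rw [mulVec_mulVec, transpose_nonsing_inv, Matrix.mul_nonsing_inv _ hut, one_mulVec]
    rw [mul_vecMulVec, vecMulVec_mul, ← mulVec_transpose, h1]
  have hsum : V + ∑ k ∈ s, vecMulVec (φ k) (φ k)
      = Aᵀ * (1 + ∑ k ∈ s, vecMulVec (ψ k) (ψ k)) * A := by
    rw [Matrix.mul_add, Matrix.add_mul, Matrix.mul_one, ← hA, Matrix.mul_sum, Matrix.sum_mul]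
    simp only [hφ]
  have htr : ∑ k ∈ s, φ k ⬝ᵥ (V⁻¹ *ᵥ φ k) = (∑ k ∈ s, vecMulVec (ψ k) (ψ k)).trace := by
    rw [trace_sum]
    refine Finset.sum_congr rfl fun k _ => ?_
    rw [dotProduct_inv_mulVec_eq hA, trace_vecMulVec]
  rw [hsum, htr, det_mul, det_mul, det_transpose, hdet]
  have := one_add_trace_le_det_one_add (posSemidef_sum_vecMulVec s ψ)
  nlinarith [sq_nonneg A.det]

theorem log_det_le {V : Matrix ι ι ℝ} (hV : V.PosDef) {τ : ℝ} (hτ : 0 < τ)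
    (htr : V.trace ≤ Fintype.card ι * τ) :
    Real.log V.det ≤ Fintype.card ι * Real.log τ := by
  have hpos := hV.eigenvalues_pos
  have h1 : Real.log V.det = ∑ i, Real.log (hV.1.eigenvalues i) := by
    rw [hV.1.det_eq_prod_eigenvalues]
    simp only [RCLike.ofReal_real_eq_id, id]
    exact Real.log_prod fun i _ => (hpos i).ne'
  -- The tangent of the logarithm at `τ` bounds every eigenvalue's contribution.
  have h2 : ∀ i, Real.log (hV.1.eigenvalues i) ≤ Real.log τ + (hV.1.eigenvalues i / τ - 1) := by
    intro i
    have := Real.log_le_sub_one_of_pos (div_pos (hpos i) hτ)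
    rw [Real.log_div (hpos i).ne' hτ.ne'] at this
    linarith
  rw [h1]
  refine (Finset.sum_le_sum fun i _ => h2 i).trans ?_
  rw [hV.1.trace_eq_sum_eigenvalues] at htr
  simp only [RCLike.ofReal_real_eq_id, id] at htr
  rw [Finset.sum_add_distrib, Finset.sum_sub_distrib, ← Finset.sum_div]
  simp only [Finset.sum_const, Finset.card_univ, nsmul_eq_mul, mul_one]
  have : (∑ i, hV.1.eigenvalues i) / τ ≤ Fintype.card ι := by rwa [div_le_iff₀ hτ]
  linarith

/-- A Gaussian integral, completed to a square: relative to the standard one, the integral of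
`exp (λ ⬝ s - λᵀ V λ / 8)` is `(det V)^(-1/2) exp (2 sᵀ V⁻¹ s)`. -/
theorem lintegral_exp_quadratic {V : Matrix ι ι ℝ} (hV : V.PosDef) (s : ι → ℝ) :
    ∫⁻ l : ι → ℝ, ENNReal.ofReal (Real.exp (l ⬝ᵥ s - l ⬝ᵥ (V *ᵥ l) / 8)) =
      ENNReal.ofReal (Real.exp (2 * (s ⬝ᵥ (V⁻¹ *ᵥ s)) - Real.log V.det / 2)) *
        ∫⁻ l : ι → ℝ, ENNReal.ofReal (Real.exp (-(l ⬝ᵥ l) / 8)) := by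
  obtain ⟨A, hA, hA0, hdet⟩ := exists_transpose_mul_self_of_posDef hV
  set f : (ι → ℝ) → ENNReal := fun l => ENNReal.ofReal (Real.exp (-(l ⬝ᵥ l) / 8)) with hf
  have hfm : Measurable f := by
    rw [hf]; simp only [dotProduct]; fun_prop
  -- The center of the Gaussian and, below, the change of variables `l ↦ A (l - μ0)`.
  set μ0 : ι → ℝ := (4 : ℝ) • (V⁻¹ *ᵥ s) with hμ0
  have hVμ : V *ᵥ μ0 = (4 : ℝ) • s := by
    rw [hμ0, mulVec_smul, mulVec_mulVec,
      Matrix.mul_nonsing_inv _ ((isUnit_iff_isUnit_det V).1 hV.isUnit), one_mulVec]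
  have hsymm : ∀ x y : ι → ℝ, x ⬝ᵥ (V *ᵥ y) = y ⬝ᵥ (V *ᵥ x) := by
    intro x y
    have : Vᵀ = V := by simpa using hV.1.eq
    rw [dotProduct_mulVec, ← mulVec_transpose, this, dotProduct_comm]
  have hAA : ∀ x : ι → ℝ, (A *ᵥ x) ⬝ᵥ (A *ᵥ x) = x ⬝ᵥ (V *ᵥ x) := by
    intro x
    rw [hA, ← mulVec_mulVec, dotProduct_mulVec, dotProduct_mulVec, vecMul_transpose,
      ← dotProduct_mulVec]
  have hpt : ∀ l : ι → ℝ, ENNReal.ofReal (Real.exp (l ⬝ᵥ s - l ⬝ᵥ (V *ᵥ l) / 8)) =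
      ENNReal.ofReal (Real.exp (2 * (s ⬝ᵥ (V⁻¹ *ᵥ s)))) * f (A *ᵥ (l - μ0)) := by
    intro l
    rw [hf]
    simp only
    rw [← ENNReal.ofReal_mul (Real.exp_nonneg _), ← Real.exp_add, hAA]
    congr 2
    rw [mulVec_sub, dotProduct_sub, sub_dotProduct, sub_dotProduct, hsymm μ0 l, hVμ,
      dotProduct_smul, dotProduct_smul, hμ0, smul_dotProduct, dotProduct_comm (V⁻¹ *ᵥ s) s]
    simp only [smul_eq_mul]
    ring
  simp only [hpt]
  have hm : Measurable fun l : ι → ℝ => f (A *ᵥ l) :=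
    hfm.comp (Continuous.measurable (by fun_prop))
  rw [lintegral_const_mul _
    (show Measurable fun l => f (A *ᵥ (l - μ0)) from hm.comp (measurable_id.sub_const μ0)),
    lintegral_sub_right_eq_self (fun l => f (A *ᵥ l)) μ0]
  have hchg : ∫⁻ l : ι → ℝ, f (A *ᵥ l) = ENNReal.ofReal |A.det⁻¹| * ∫⁻ l, f l := by
    have h := Real.map_matrix_volume_pi_eq_smul_volume_pi hA0
    have h2 := lintegral_map (μ := volume) hfm
      (show Measurable (toLin' A) from Continuous.measurable (by
        show Continuous fun l => A *ᵥ l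
        fun_prop))
    rw [h, lintegral_smul_measure] at h2
    simp only [toLin'_apply] at h2
    rw [← h2, smul_eq_mul]
  have hlog : |A.det⁻¹| = Real.exp (-(Real.log V.det / 2)) := by
    rw [hdet, Real.log_pow, abs_inv, ← Real.exp_log (abs_pos.2 hA0), ← Real.exp_neg, Real.log_abs]
    congr 1
    push_cast
    ring
  rw [hchg, ← mul_assoc, ← ENNReal.ofReal_mul (Real.exp_nonneg _), hlog, ← Real.exp_add,
    ← sub_eq_add_neg]

theorem lintegral_exp_neg_sq_ne_zero {ι : Type*} [Fintype ι] :
    ∫⁻ l : ι → ℝ, ENNReal.ofReal (Real.exp (-(l ⬝ᵥ l) / 8)) ≠ 0 := by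
  have hfm : Measurable fun l : ι → ℝ => ENNReal.ofReal (Real.exp (-(l ⬝ᵥ l) / 8)) := by
    simp only [dotProduct]; fun_prop
  rw [← pos_iff_ne_zero, lintegral_pos_iff_support hfm]
  have : Function.support (fun l : ι → ℝ => ENNReal.ofReal (Real.exp (-(l ⬝ᵥ l) / 8))) =
      Set.univ := by
    ext l
    simp [Real.exp_pos]
  rw [this]
  exact isOpen_univ.measure_pos volume Set.univ_nonempty

theorem lintegral_exp_neg_sq_ne_top {ι : Type*} [Fintype ι] :
    ∫⁻ l : ι → ℝ, ENNReal.ofReal (Real.exp (-(l ⬝ᵥ l) / 8)) ≠ ⊤ := by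
  have h : Integrable fun l : ι → ℝ => ∏ i, Real.exp (-(1 / 8) * (l i) ^ 2) :=
    Integrable.fintype_prod fun _ => integrable_exp_neg_mul_sq (by norm_num)
  have h2 : (fun l : ι → ℝ => ∏ i, Real.exp (-(1 / 8) * (l i) ^ 2)) =
      fun l => Real.exp (-(l ⬝ᵥ l) / 8) := by
    funext l
    rw [← Real.exp_sum, ← Finset.mul_sum, dotProduct]
    congr 1
    simp only [← sq]
    ring
  rw [h2] at h
  have := h.lintegral_lt_top
  exact this.ne

end LinearAlgebra

/-! ### The statistics as a block-eliminated ridge regression -/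

/-- The stacked feature vector of item `a` ranked below the items of `S`: its coverage gain
together with its relevance feature. -/
def feature {L m d : ℕ} (x : Fin L → Fin d → ℝ) (z : Fin L → Fin m → ℝ) (S : Finset (Fin L))
    (a : Fin L) : Fin d ⊕ Fin m → ℝ :=
  Sum.elim (gain x S a) (z a)

/-- The stacked feature vector of the item at position `k` of the list `R`. -/
def listFeature {L K m d : ℕ} (x : Fin L → Fin d → ℝ) (z : Fin L → Fin m → ℝ)
    (R : Fin K ↪ Fin L) (k : Fin K) : Fin d ⊕ Fin m → ℝ :=
  feature x z (above R k) (R k)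

theorem attraction_eq_feature_dotProduct {L m d : ℕ} (x : Fin L → Fin d → ℝ)
    (z : Fin L → Fin m → ℝ) (θ : Fin d → ℝ) (β : Fin m → ℝ) (S : Finset (Fin L)) (a : Fin L) :
    attraction x z θ β S a = feature x z S a ⬝ᵥ Sum.elim θ β := by
  rw [attraction, feature, sumElim_dotProduct_sumElim, add_comm]

/-- The positions of a list of length `K` that are observed when the click is at position `c`. -/
def observed (K c : ℕ) : Finset (Fin K) :=
  Finset.univ.filter fun k => (k : ℕ) ≤ c

namespace Stats

variable {m d : ℕ}

/-- The regularized Gram matrix of the observed stacked features. The algorithm stores the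
Schur complement of its lower right block in the field `H`. -/
noncomputable def gram (s : Stats m d) : Matrix (Fin d ⊕ Fin m) (Fin d ⊕ Fin m) ℝ :=
  fromBlocks (s.H + s.B * s.M⁻¹ * s.Bᵀ) s.B s.Bᵀ s.M

/-- The sum of the stacked features of the clicked items. -/
noncomputable def response (s : Stats m d) : Fin d ⊕ Fin m → ℝ :=
  Sum.elim (s.u + (s.B * s.M⁻¹) *ᵥ s.y) s.y

/-- The accumulated noise of the observed attraction indicators, when their means are given by
the stacked parameter vector `w`. -/
noncomputable def noise (s : Stats m d) (w : Fin d ⊕ Fin m → ℝ) : Fin d ⊕ Fin m → ℝ :=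
  s.response - (s.gram - 1) *ᵥ w

theorem gram_init : (init m d).gram = 1 := by
  simp [gram, init]

theorem noise_init (w : Fin d ⊕ Fin m → ℝ) : (init m d).noise w = 0 := by
  rw [noise, gram_init]
  funext i
  rcases i with i | i <;> simp [response, init]

section Update

variable {L K : ℕ} (x : Fin L → Fin d → ℝ) (z : Fin L → Fin m → ℝ) (s : Stats m d)
  (R : Fin K ↪ Fin L) (c : ℕ)

theorem gram_update :
    (update x z s R c).gram =
      s.gram + ∑ k ∈ observed K c, vecMulVec (listFeature x z R k) (listFeature x z R k) := by
  ext i j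
  rcases i with i | i <;> rcases j with j | j <;>
    simp [gram, update, observed, listFeature, feature, Matrix.sum_apply, vecMulVec_apply,
      mul_comm]

theorem response_update :
    (update x z s R c).response =
      s.response + if h : c < K then listFeature x z R ⟨c, h⟩ else 0 := by
  funext i
  by_cases h : c < K <;> rcases i with i | i <;>
    simp [response, update, listFeature, feature, h]

end Update

section Inverse

variable {s : Stats m d}

theorem posDef_M (hs : s.gram.PosDef) : s.M.PosDef := by
  have := hs.submatrix (e := (Sum.inr : Fin m → Fin d ⊕ Fin m)) Sum.inr_injective
  exact this

theorem transpose_M (hs : s.gram.PosDef) : s.Mᵀ = s.M := by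
  simpa using (posDef_M hs).1.eq

theorem transpose_H (hs : s.gram.PosDef) : s.Hᵀ = s.H := by
  have h1 : (s.H + s.B * s.M⁻¹ * s.Bᵀ)ᵀ = s.H + s.B * s.M⁻¹ * s.Bᵀ := by
    have h := (hs.submatrix (e := (Sum.inl : Fin d → Fin d ⊕ Fin m)) Sum.inl_injective).1.eq
    exact h
  rw [transpose_add, transpose_mul, transpose_mul, transpose_nonsing_inv, transpose_M hs,
    transpose_transpose, ← Matrix.mul_assoc] at h1
  exact add_right_cancel h1

/-- The inverse Gram matrix in terms of the stored blocks. -/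
theorem gram_inv (hs : s.gram.PosDef) :
    s.gram⁻¹ = fromBlocks s.H⁻¹ (-(s.H⁻¹ * s.B * s.M⁻¹)) (-(s.M⁻¹ * s.Bᵀ * s.H⁻¹))
      (s.M⁻¹ + s.M⁻¹ * s.Bᵀ * s.H⁻¹ * s.B * s.M⁻¹) := by
  have hM : IsUnit s.M.det := (isUnit_iff_isUnit_det _).1 (posDef_M hs).isUnit
  let := s.M.invertibleOfIsUnitDet hM
  have hS : s.H + s.B * s.M⁻¹ * s.Bᵀ - s.B * ⅟s.M * s.Bᵀ = s.H := by
    rw [invOf_eq_nonsing_inv, add_sub_cancel_right]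
  have hG : IsUnit s.gram.det := (isUnit_iff_isUnit_det _).1 hs.isUnit
  have hH : IsUnit s.H.det := by
    have h := hG
    rw [gram, det_fromBlocks₂₂, hS] at h
    exact isUnit_of_mul_isUnit_right h
  let : Invertible (s.H + s.B * s.M⁻¹ * s.Bᵀ - s.B * ⅟s.M * s.Bᵀ) := by
    rw [hS]; exact s.H.invertibleOfIsUnitDet hH
  let : Invertible (fromBlocks (s.H + s.B * s.M⁻¹ * s.Bᵀ) s.B s.Bᵀ s.M) :=
    s.gram.invertibleOfIsUnitDet hG
  have h := invOf_fromBlocks₂₂_eq (s.H + s.B * s.M⁻¹ * s.Bᵀ) s.B s.Bᵀ s.M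
  simp only [invOf_eq_nonsing_inv, add_sub_cancel_right] at h
  exact h

theorem width_eq (hs : s.gram.PosDef) (ω : Fin d → ℝ) (ζ : Fin m → ℝ) :
    s.width ω ζ = Sum.elim ω ζ ⬝ᵥ (s.gram⁻¹ *ᵥ Sum.elim ω ζ) := by
  have hcross : ζ ⬝ᵥ ((s.M⁻¹ * s.Bᵀ * s.H⁻¹) *ᵥ ω) = ω ⬝ᵥ ((s.H⁻¹ * s.B * s.M⁻¹) *ᵥ ζ) := by
    rw [dotProduct_mulVec, ← mulVec_transpose, dotProduct_comm, transpose_mul, transpose_mul,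
      transpose_nonsing_inv, transpose_nonsing_inv, transpose_M hs, transpose_H hs,
      transpose_transpose, Matrix.mul_assoc]
  rw [gram_inv hs, fromBlocks_mulVec, sumElim_dotProduct_sumElim]
  simp only [Sum.elim_comp_inl, Sum.elim_comp_inr, dotProduct_add, neg_mulVec, dotProduct_neg,
    add_mulVec, hcross, width]
  ring

theorem estimate_eq (hs : s.gram.PosDef) (ω : Fin d → ℝ) (ζ : Fin m → ℝ) :
    ω ⬝ᵥ s.thetaHat + ζ ⬝ᵥ s.betaHat = Sum.elim ω ζ ⬝ᵥ (s.gram⁻¹ *ᵥ s.response) := by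
  rw [gram_inv hs, fromBlocks_mulVec, sumElim_dotProduct_sumElim, response]
  congr 2
  · simp only [Sum.elim_comp_inl, Sum.elim_comp_inr, thetaHat, mulVec_add, neg_mulVec,
      mulVec_mulVec, Matrix.mul_assoc]
    abel
  · simp only [Sum.elim_comp_inl, Sum.elim_comp_inr, betaHat, mulVec_add, mulVec_sub, neg_mulVec,
      add_mulVec, mulVec_mulVec, Matrix.mul_assoc, Matrix.neg_mul]
    abel

end Inverse

section Trajectory

variable {L K : ℕ} (x : Fin L → Fin d → ℝ) (z : Fin L → Fin m → ℝ)
  (R : ℕ → Fin K ↪ Fin L) (c : ℕ → ℕ)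

theorem gram_atTime_sub_one_posSemidef (t : ℕ) : ((atTime x z R c t).gram - 1).PosSemidef := by
  induction t with
  | zero => rw [atTime, gram_init, sub_self]; exact PosSemidef.zero
  | succ t ih =>
    rw [atTime, gram_update, add_sub_right_comm]
    exact ih.add (posSemidef_sum_vecMulVec _ _)

theorem gram_atTime_posDef (t : ℕ) : (atTime x z R c t).gram.PosDef := by
  have := PosDef.one.add_posSemidef (gram_atTime_sub_one_posSemidef x z R c t)
  rwa [add_sub_cancel] at this

end Trajectory

/-- On the confidence event, the deviation of the estimated attraction probability is at most
`γ` times the confidence width. -/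
theorem abs_estimate_sub_le {s : Stats m d} (hs : (s.gram - 1).PosSemidef)
    (w : Fin d ⊕ Fin m → ℝ) {γ : ℝ}
    (hγ : √(s.noise w ⬝ᵥ (s.gram⁻¹ *ᵥ s.noise w)) + √(w ⬝ᵥ w) ≤ γ)
    (ω : Fin d → ℝ) (ζ : Fin m → ℝ) :
    |ω ⬝ᵥ s.thetaHat + ζ ⬝ᵥ s.betaHat - Sum.elim ω ζ ⬝ᵥ w| ≤ γ * √(s.width ω ζ) := by
  have hV : s.gram.PosDef := by
    have := PosDef.one.add_posSemidef hs
    rwa [add_sub_cancel] at this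
  set φ : Fin d ⊕ Fin m → ℝ := Sum.elim ω ζ
  have hres : s.gram⁻¹ *ᵥ s.response - w = s.gram⁻¹ *ᵥ s.noise w - s.gram⁻¹ *ᵥ w := by
    rw [noise, mulVec_sub, sub_mulVec, mulVec_sub, mulVec_mulVec,
      Matrix.nonsing_inv_mul _ ((isUnit_iff_isUnit_det _).1 hV.isUnit), one_mulVec]
    abel
  rw [estimate_eq hV, width_eq hV, ← dotProduct_sub, hres, dotProduct_sub]
  have h1 := abs_dotProduct_inv_mulVec_le hV φ (s.noise w)
  have h2 := abs_dotProduct_inv_mulVec_le hV φ w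
  have h3 : √(w ⬝ᵥ (s.gram⁻¹ *ᵥ w)) ≤ √(w ⬝ᵥ w) := by
    have := sqrt_dotProduct_inv_mulVec_le hs w
    rwa [add_sub_cancel] at this
  have h4 := Real.sqrt_nonneg (φ ⬝ᵥ (s.gram⁻¹ *ᵥ φ))
  calc _ ≤ |φ ⬝ᵥ (s.gram⁻¹ *ᵥ s.noise w)| + |φ ⬝ᵥ (s.gram⁻¹ *ᵥ w)| := abs_sub _ _
    _ ≤ √(φ ⬝ᵥ (s.gram⁻¹ *ᵥ φ)) * (√(s.noise w ⬝ᵥ (s.gram⁻¹ *ᵥ s.noise w)) + √(w ⬝ᵥ w)) := by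
      rw [mul_add]
      exact add_le_add h1 (h2.trans (mul_le_mul_of_nonneg_left h3 h4))
    _ ≤ _ := by rw [mul_comm]; exact mul_le_mul_of_nonneg_right hγ h4

end Stats

section FeatureSize

variable {L K m d : ℕ} {x : Fin L → Fin d → ℝ} {z : Fin L → Fin m → ℝ}

theorem gain_apply {S : Finset (Fin L)} {a : Fin L} (ha : a ∉ S) (j : Fin d) :
    gain x S a j = x a j * ∏ b ∈ S, (1 - x b j) := by
  rw [gain, coverage, coverage, Finset.prod_insert ha]
  ring

theorem gain_mem_Icc (hx : ∀ a j, x a j ∈ Set.Icc (0 : ℝ) 1) {S : Finset (Fin L)} {a : Fin L}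
    (ha : a ∉ S) (j : Fin d) : gain x S a j ∈ Set.Icc (0 : ℝ) 1 := by
  have h0 : 0 ≤ ∏ b ∈ S, (1 - x b j) :=
    Finset.prod_nonneg fun b _ => sub_nonneg.2 (hx b j).2
  have h1 : ∏ b ∈ S, (1 - x b j) ≤ 1 :=
    Finset.prod_le_one (fun b _ => sub_nonneg.2 (hx b j).2) fun b _ => by
      linarith [(hx b j).1]
  rw [gain_apply ha]
  exact ⟨mul_nonneg (hx a j).1 h0, mul_le_one₀ (hx a j).2 h0 h1⟩

theorem notMem_above (R : Fin K ↪ Fin L) (k : Fin K) : R k ∉ above R k := by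
  simp [above]

/-- The set of the first `n` positions of a list of length `K`. -/
def firstPositions (K n : ℕ) : Finset (Fin K) :=
  Finset.univ.filter fun k => (k : ℕ) < n

theorem mem_firstPositions {n : ℕ} {k : Fin K} : k ∈ firstPositions K n ↔ (k : ℕ) < n := by
  simp [firstPositions]

theorem firstPositions_succ (k : Fin K) :
    firstPositions K (k + 1) = insert k (firstPositions K k) := by
  ext i
  simp only [mem_firstPositions, Finset.mem_insert, Fin.ext_iff]
  omega

theorem firstPositions_self : firstPositions K K = Finset.univ := by
  ext i
  simp [mem_firstPositions]

/-- The set of the first `n` items of the list `R`. -/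
def firstItems (R : Fin K ↪ Fin L) (n : ℕ) : Finset (Fin L) :=
  (firstPositions K n).map R

theorem firstItems_zero (R : Fin K ↪ Fin L) : firstItems R 0 = ∅ := by
  simp [firstItems, firstPositions]

theorem firstItems_eq_above (R : Fin K ↪ Fin L) (k : Fin K) : firstItems R k = above R k := by
  rw [firstItems, above]
  congr 1
  ext i
  simp [mem_firstPositions]

theorem firstItems_succ (R : Fin K ↪ Fin L) (k : Fin K) :
    firstItems R (k + 1) = insert (R k) (above R k) := by
  rw [← firstItems_eq_above, firstItems, firstPositions_succ, Finset.map_insert, firstItems]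

/-- Marginal gains along a list telescope. -/
theorem sum_marginal_eq (R : Fin K ↪ Fin L) (g : Finset (Fin L) → ℝ) :
    ∑ k, (g (insert (R k) (above R k)) - g (above R k)) = g (firstItems R K) - g ∅ := by
  have h : ∀ k : Fin K, g (insert (R k) (above R k)) - g (above R k) =
      (fun i : ℕ => g (firstItems R (i + 1)) - g (firstItems R i)) k := by
    intro k
    simp only [firstItems_succ, firstItems_eq_above]
  rw [Finset.sum_congr rfl fun k _ => h k,
    Fin.sum_univ_eq_sum_range (fun i : ℕ => g (firstItems R (i + 1)) - g (firstItems R i)),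
    Finset.sum_range_sub (fun i => g (firstItems R i)), firstItems_zero]

/-- The squared coverage gains along a list add up to at most `1` per topic, since the gains
themselves telescope. -/
theorem sum_listFeature_sq_le (hx : ∀ a j, x a j ∈ Set.Icc (0 : ℝ) 1)
    (hz : ∀ a, ‖(WithLp.toLp 2 (z a) : EuclideanSpace ℝ (Fin m))‖ ≤ 1) (R : Fin K ↪ Fin L) :
    ∑ k, listFeature x z R k ⬝ᵥ listFeature x z R k ≤ K + d := by
  have hz2 : ∀ a, z a ⬝ᵥ z a ≤ 1 := by
    intro a
    have h := hz a
    have h2 : ‖(WithLp.toLp 2 (z a) : EuclideanSpace ℝ (Fin m))‖ ^ 2 = z a ⬝ᵥ z a := by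
      rw [EuclideanSpace.norm_sq_eq]
      simp [dotProduct, sq]
    rw [← h2]
    exact pow_le_one₀ (norm_nonneg _) h
  have hg : ∀ k, gain x (above R k) (R k) ⬝ᵥ gain x (above R k) (R k) ≤
      ∑ j, gain x (above R k) (R k) j := by
    intro k
    refine Finset.sum_le_sum fun j _ => ?_
    have := gain_mem_Icc hx (notMem_above R k) j
    nlinarith [this.1, this.2]
  have hcov : ∀ j, ∑ k, gain x (above R k) (R k) j ≤ 1 := by
    intro j
    have h := sum_marginal_eq R (fun S => coverage x S j)
    simp only [gain]
    rw [h]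
    have : 0 ≤ ∏ a ∈ firstItems R K, (1 - x a j) :=
      Finset.prod_nonneg fun b _ => sub_nonneg.2 (hx b j).2
    simp only [coverage, Finset.prod_empty]
    linarith
  calc ∑ k, listFeature x z R k ⬝ᵥ listFeature x z R k
      ≤ ∑ k : Fin K, (∑ j, gain x (above R k) (R k) j + 1) := by
        refine Finset.sum_le_sum fun k _ => ?_
        rw [listFeature, feature, sumElim_dotProduct_sumElim]
        exact add_le_add (hg k) (hz2 _)
    _ = ∑ j, ∑ k : Fin K, gain x (above R k) (R k) j + K := by
        rw [Finset.sum_add_distrib, Finset.sum_comm]; simp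
    _ ≤ ∑ _j : Fin d, 1 + K := by
        gcongr with j; exact hcov j
    _ = K + d := by simp [add_comm]

theorem trace_gram_atTime_le (hx : ∀ a j, x a j ∈ Set.Icc (0 : ℝ) 1)
    (hz : ∀ a, ‖(WithLp.toLp 2 (z a) : EuclideanSpace ℝ (Fin m))‖ ≤ 1)
    (R : ℕ → Fin K ↪ Fin L) (c : ℕ → ℕ) (t : ℕ) :
    (Stats.atTime x z R c t).gram.trace ≤ (m + d) + t * (K + d) := by
  induction t with
  | zero => simp [Stats.atTime, Stats.gram_init, add_comm]
  | succ t ih =>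
    rw [Stats.atTime, Stats.gram_update, trace_add, trace_sum]
    have h : ∑ k ∈ observed K (c t),
        (vecMulVec (listFeature x z (R t) k) (listFeature x z (R t) k)).trace ≤ K + d := by
      simp only [trace_vecMulVec]
      refine le_trans ?_ (sum_listFeature_sq_le hx hz (R t))
      exact Finset.sum_le_sum_of_subset_of_nonneg (Finset.subset_univ _) fun k _ _ =>
        Finset.sum_nonneg fun i _ => mul_self_nonneg _
    push_cast
    linarith

end FeatureSize

/-! ### Cascades of independent Bernoulli variables -/

/-- The probability of the pattern `b` under independent Bernoulli variables with means `p`. -/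
def patternProb {K : ℕ} (p : Fin K → ℝ) (b : Fin K → Bool) : ℝ :=
  ∏ k, if b k = true then p k else 1 - p k

/-- The first position at which the pattern `b` is `true`, and `K` if there is none. -/
def firstTrue {K : ℕ} (b : Fin K → Bool) : ℕ :=
  (List.ofFn b).findIdx id

theorem firstTrue_cons_true {K : ℕ} (b : Fin K → Bool) :
    firstTrue (Fin.cons true b : Fin (K + 1) → Bool) = 0 := by
  simp [firstTrue, List.ofFn_succ, List.findIdx_cons]

theorem firstTrue_cons_false {K : ℕ} (b : Fin K → Bool) :
    firstTrue (Fin.cons false b : Fin (K + 1) → Bool) = firstTrue b + 1 := by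
  simp [firstTrue, List.ofFn_succ, List.findIdx_cons]

theorem eq_true_iff_of_le_firstTrue {K : ℕ} (b : Fin K → Bool) {k : Fin K}
    (hk : (k : ℕ) ≤ firstTrue b) : b k = true ↔ (k : ℕ) = firstTrue b := by
  have hlen : (k : ℕ) < (List.ofFn b).length := by simp
  constructor
  · intro hb
    by_contra hne
    have h := List.not_of_lt_findIdx (p := id) (xs := List.ofFn b) (i := k)
      (lt_of_le_of_ne hk hne)
    simp [hb] at h
  · intro h
    have hlt : (List.ofFn b).findIdx id < (List.ofFn b).length := by
      rw [firstTrue] at h; omega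
    have := List.findIdx_getElem (p := id) (xs := List.ofFn b) (w := hlt)
    rw [firstTrue] at h
    simp only [← h] at this
    simpa using this

theorem sum_observed_zero {K : ℕ} {E : Type*} [AddCommMonoid E] (f : Fin (K + 1) → E) :
    ∑ k ∈ observed (K + 1) 0, f k = f 0 := by
  rw [observed, Finset.sum_filter, Fin.sum_univ_succ]
  simp

theorem sum_observed_succ {K : ℕ} {E : Type*} [AddCommMonoid E] (f : Fin (K + 1) → E) (c : ℕ) :
    ∑ k ∈ observed (K + 1) (c + 1), f k = f 0 + ∑ k ∈ observed K c, f k.succ := by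
  rw [observed, observed, Finset.sum_filter, Fin.sum_univ_succ, Finset.sum_filter]
  simp

/-- Among the observed positions only the click position, if any, carries a `true`. -/
theorem sum_observed_indicator {K : ℕ} {E : Type*} [AddCommGroup E] [Module ℝ E]
    (b : Fin K → Bool) (φ : Fin K → E) :
    ∑ k ∈ observed K (firstTrue b), (if b k = true then (1 : ℝ) else 0) • φ k =
      if h : firstTrue b < K then φ ⟨firstTrue b, h⟩ else 0 := by
  have h1 : ∀ k ∈ observed K (firstTrue b), (if b k = true then (1 : ℝ) else 0) • φ k =
      if (k : ℕ) = firstTrue b then φ k else 0 := by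
    intro k hk
    rw [observed, Finset.mem_filter] at hk
    simp [eq_true_iff_of_le_firstTrue b hk.2]
  rw [Finset.sum_congr rfl h1]
  split_ifs with h
  · rw [Finset.sum_eq_single_of_mem ⟨firstTrue b, h⟩ (by simp [observed])]
    · simp
    · intro k _ hk
      rw [if_neg]
      exact fun h' => hk (Fin.ext h')
  · refine Finset.sum_eq_zero fun k _ => ?_
    rw [if_neg]
    have := k.2
    omega

theorem sum_patternProb_succ {K : ℕ} (p : Fin (K + 1) → ℝ) (F : (Fin (K + 1) → Bool) → ℝ) :
    ∑ b, patternProb p b * F b =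
      p 0 * ∑ b, patternProb (fun k => p k.succ) b * F (Fin.cons true b) +
      (1 - p 0) * ∑ b, patternProb (fun k => p k.succ) b * F (Fin.cons false b) := by
  rw [← (Fin.consEquiv fun _ : Fin (K + 1) => Bool).sum_comp, Fintype.sum_prod_type]
  simp only [Fintype.sum_bool, Finset.mul_sum, Fin.consEquiv, Equiv.coe_fn_mk]
  congr 1 <;> refine Finset.sum_congr rfl fun b _ => ?_ <;>
    simp only [patternProb, Fin.prod_univ_succ, Fin.cons_zero, Fin.cons_succ, if_true, mul_assoc,
      Bool.false_eq_true, if_false]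

theorem sum_prod_pattern {K : ℕ} (f : Fin K → Bool → ℝ) :
    ∑ b : Fin K → Bool, ∏ k, f k (b k) = ∏ k, (f k true + f k false) := by
  have h := Finset.prod_univ_sum (fun _ : Fin K => (Finset.univ : Finset Bool)) f
  rw [Fintype.piFinset_univ] at h
  rw [← h]
  simp

theorem sum_patternProb {K : ℕ} (p : Fin K → ℝ) : ∑ b, patternProb p b = 1 := by
  have := sum_prod_pattern fun k b => if b = true then p k else 1 - p k
  simpa [patternProb] using this

theorem patternProb_nonneg {K : ℕ} {p : Fin K → ℝ} (hp : ∀ k, p k ∈ Set.Icc (0 : ℝ) 1)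
    (b : Fin K → Bool) : 0 ≤ patternProb p b := by
  refine Finset.prod_nonneg fun k _ => ?_
  have := hp k
  split_ifs
  · exact this.1
  · linarith [this.2]

theorem sum_patternProb_mul_reward {K : ℕ} (p : Fin K → ℝ) :
    ∑ b, patternProb p b * (1 - ∏ k, (1 - if b k = true then (1 : ℝ) else 0)) =
      1 - ∏ k, (1 - p k) := by
  simp only [mul_sub, mul_one, Finset.sum_sub_distrib, sum_patternProb]
  congr 1
  have := sum_prod_pattern fun k b =>
    (if b = true then p k else 1 - p k) * (1 - if b = true then (1 : ℝ) else 0)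
  simp only [patternProb, ← Finset.prod_mul_distrib]
  rw [this]
  simp

/-- A product of factors of mean at most one, stopped at the first success, has mean at most
one. -/
theorem sum_patternProb_mul_exp_le_one {K : ℕ} {p : Fin K → ℝ}
    (hp : ∀ k, p k ∈ Set.Icc (0 : ℝ) 1) (ψ : Fin K → Bool → ℝ)
    (hψ : ∀ k, p k * Real.exp (ψ k true) + (1 - p k) * Real.exp (ψ k false) ≤ 1) :
    ∑ b, patternProb p b * Real.exp (∑ k ∈ observed K (firstTrue b), ψ k (b k)) ≤ 1 := by
  induction K with
  | zero => simp [patternProb, observed]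
  | succ K ih =>
    rw [sum_patternProb_succ]
    simp only [firstTrue_cons_true, firstTrue_cons_false, sum_observed_zero, sum_observed_succ,
      Fin.cons_zero, Fin.cons_succ, Real.exp_add]
    have h := ih (p := fun k => p k.succ) (fun k => hp k.succ) (fun k => ψ k.succ)
      fun k => hψ k.succ
    rw [← Finset.sum_mul, sum_patternProb, one_mul]
    have h2 : ∑ b, patternProb (fun k => p k.succ) b * (Real.exp (ψ 0 false) *
        Real.exp (∑ k ∈ observed K (firstTrue b), ψ k.succ (b k))) ≤ Real.exp (ψ 0 false) := by
      simp only [mul_left_comm _ (Real.exp (ψ 0 false))]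
      rw [← Finset.mul_sum]
      exact mul_le_of_le_one_right (Real.exp_nonneg _) h
    have h3 := mul_le_mul_of_nonneg_left h2 (sub_nonneg.2 (hp 0).2)
    linarith [hψ 0]

/-- Lowering the success probabilities from `q` to `p` lowers the probability of some success by
at most the expected total of `e ≥ q - p` over the positions up to the first success; here the
total may even be truncated at `1`. -/
theorem prod_sub_prod_le_sum_patternProb {K : ℕ} {p q e : Fin K → ℝ}
    (hp : ∀ k, 0 ≤ p k) (hpq : ∀ k, p k ≤ q k) (hq : ∀ k, q k ≤ 1)
    (he : ∀ k, q k - p k ≤ e k) :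
    ∏ k, (1 - p k) - ∏ k, (1 - q k) ≤
      ∑ b, patternProb p b * min 1 (∑ k ∈ observed K (firstTrue b), e k) := by
  induction K with
  | zero => simp [patternProb, observed]
  | succ K ih =>
    rw [sum_patternProb_succ]
    simp only [firstTrue_cons_true, firstTrue_cons_false, sum_observed_zero, sum_observed_succ]
    have h := ih (p := fun k => p k.succ) (q := fun k => q k.succ) (e := fun k => e k.succ)
      (fun k => hp k.succ) (fun k => hpq k.succ) (fun k => hq k.succ) fun k => he k.succ
    rw [← Finset.sum_mul, sum_patternProb, one_mul, Fin.prod_univ_succ, Fin.prod_univ_succ]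
    have hP1 : ∏ k : Fin K, (1 - p k.succ) ≤ 1 :=
      Finset.prod_le_one (fun k _ => by linarith [hpq k.succ, hq k.succ])
        fun k _ => by linarith [hp k.succ]
    have hQ0 : 0 ≤ ∏ k : Fin K, (1 - q k.succ) :=
      Finset.prod_nonneg fun k _ => by linarith [hq k.succ]
    have hQP : ∏ k : Fin K, (1 - q k.succ) ≤ ∏ k : Fin K, (1 - p k.succ) :=
      Finset.prod_le_prod (fun k _ => by linarith [hq k.succ]) fun k _ => by
        linarith [hpq k.succ]
    set P := ∏ k : Fin K, (1 - p k.succ)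
    set Q := ∏ k : Fin K, (1 - q k.succ)
    set r := min 1 (e 0) with hr
    set G := ∑ b, patternProb (fun k => p k.succ) b *
      min 1 (∑ k ∈ observed K (firstTrue b), e k.succ) with hG
    have hr1 : r ≤ 1 := min_le_left _ _
    have hre : r ≤ e 0 := min_le_right _ _
    have hrδ : q 0 - p 0 ≤ r := le_min (by linarith [hq 0, hp 0]) (he 0)
    have hr0 : 0 ≤ r := by linarith [hpq 0]
    have hnn : ∀ k, 0 ≤ e k := fun k => by linarith [he k, hpq k]
    -- `min 1 (r + X) ≥ r + (1 - r) * min 1 X` for `0 ≤ r ≤ 1` and `X ≥ 0`.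
    have hstep : r + (1 - r) * G ≤ ∑ b, patternProb (fun k => p k.succ) b *
        min 1 (e 0 + ∑ k ∈ observed K (firstTrue b), e k.succ) := by
      have h1 : r = ∑ b, patternProb (fun k => p k.succ) b * r := by
        rw [← Finset.sum_mul, sum_patternProb, one_mul]
      nth_rewrite 1 [h1]
      rw [hG, Finset.mul_sum, ← Finset.sum_add_distrib]
      refine Finset.sum_le_sum fun b _ => ?_
      have hb := patternProb_nonneg (p := fun k => p k.succ)
        (fun k => ⟨hp k.succ, (hpq k.succ).trans (hq k.succ)⟩) b
      have hX : 0 ≤ ∑ k ∈ observed K (firstTrue b), e k.succ :=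
        Finset.sum_nonneg fun k _ => hnn _
      generalize ∑ k ∈ observed K (firstTrue b), e k.succ = X at hX ⊢
      rw [mul_left_comm, ← mul_add]
      refine mul_le_mul_of_nonneg_left (le_min ?_ ?_) hb
      · nlinarith [min_le_left 1 X]
      · nlinarith [min_le_right 1 X, le_min zero_le_one hX]
    have hp1 : 0 ≤ 1 - p 0 := by linarith [hpq 0, hq 0]
    have h2 := mul_le_mul_of_nonneg_left hstep hp1
    refine le_trans ?_ (add_le_add_right h2 _)
    have h3 : 0 ≤ (1 - p 0) * (1 - r) * (G - (P - Q)) :=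
      mul_nonneg (mul_nonneg hp1 (by linarith)) (by linarith)
    have h4 : 0 ≤ r * (1 - (1 - p 0) * (P - Q) - Q) := by
      refine mul_nonneg hr0 ?_
      nlinarith [hp 0]
    have h5 : 0 ≤ (r - (q 0 - p 0)) * Q := mul_nonneg (by linarith) hQ0
    nlinarith

/-- Hoeffding's lemma for a Bernoulli variable. -/
theorem bernoulli_exp_le_one {p : ℝ} (hp : p ∈ Set.Icc (0 : ℝ) 1) (l : ℝ) :
    p * Real.exp (l * (1 - p) - l ^ 2 / 8) + (1 - p) * Real.exp (l * (0 - p) - l ^ 2 / 8) ≤ 1 := by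
  let ν : Measure Bool := ENNReal.ofReal p • Measure.dirac true +
    ENNReal.ofReal (1 - p) • Measure.dirac false
  let X : Bool → ℝ := fun b => if b then 1 else 0
  have h1p : 0 ≤ 1 - p := sub_nonneg.2 hp.2
  have : IsProbabilityMeasure ν := ⟨by
    simp [ν, ← ENNReal.ofReal_add hp.1 h1p]⟩
  have hint : ∀ f : Bool → ℝ, ∫ b, f b ∂ν = p * f true + (1 - p) * f false := by
    intro f
    rw [integral_add_measure, integral_smul_measure, integral_smul_measure, integral_dirac,
      integral_dirac, ENNReal.toReal_ofReal hp.1, ENNReal.toReal_ofReal h1p]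
    · simp
    · exact Integrable.of_finite.smul_measure ENNReal.ofReal_ne_top
    · exact Integrable.of_finite.smul_measure ENNReal.ofReal_ne_top
  have h := ProbabilityTheory.hasSubgaussianMGF_of_mem_Icc (μ := ν) (X := X) (a := 0) (b := 1)
    (by fun_prop) (Filter.Eventually.of_forall fun b => by cases b <;> simp [X])
  have h2 := h.mgf_le l
  rw [ProbabilityTheory.mgf, hint, hint] at h2
  simp only [X, if_true, Bool.false_eq_true, if_false, mul_one, mul_zero, add_zero] at h2
  have hc : ((((‖(1 : ℝ) - 0‖₊ / 2) ^ 2 : NNReal)) : ℝ) * l ^ 2 / 2 = l ^ 2 / 8 := by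
    simp
    ring
  rw [hc] at h2
  rw [Real.exp_sub, Real.exp_sub, mul_div_assoc', mul_div_assoc', ← add_div,
    div_le_one (Real.exp_pos _)]
  exact h2

/-! ### Greedy lists in the cascade model -/

theorem one_sub_prod_le_sum {κ : Type*} (s : Finset κ) (q : κ → ℝ)
    (hq : ∀ k, q k ∈ Set.Icc (0 : ℝ) 1) : 1 - ∏ k ∈ s, (1 - q k) ≤ ∑ k ∈ s, q k := by
  classical
  induction s using Finset.induction_on with
  | empty => simp
  | insert a s ha ih =>
    rw [Finset.prod_insert ha, Finset.sum_insert ha]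
    have h1 : ∏ k ∈ s, (1 - q k) ≤ 1 :=
      Finset.prod_le_one (fun k _ => sub_nonneg.2 (hq k).2) fun k _ => by linarith [(hq k).1]
    nlinarith [(hq a).1]

theorem sum_mul_le_one_sub_prod {κ : Type*} (s : Finset κ) (q : κ → ℝ)
    (hq : ∀ k, q k ∈ Set.Icc (0 : ℝ) 1) {M : ℝ} (hM : ∀ k, q k ≤ M) :
    (1 - ((s.card : ℝ) - 1) / 2 * M) * ∑ k ∈ s, q k ≤ 1 - ∏ k ∈ s, (1 - q k) := by
  classical
  induction s using Finset.induction_on with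
  | empty => simp
  | insert a s ha ih =>
    have h1 := one_sub_prod_le_sum s q hq
    have h2 : ∑ k ∈ s, q k ≤ s.card * M := by
      simpa using Finset.sum_le_card_nsmul s q M fun k _ => hM k
    have h0 : 0 ≤ ∑ k ∈ s, q k := Finset.sum_nonneg fun k _ => (hq k).1
    rw [Finset.prod_insert ha, Finset.sum_insert ha, Finset.card_insert_of_notMem ha]
    push_cast
    generalize ∑ k ∈ s, q k = S at *
    generalize ∏ k ∈ s, (1 - q k) = P at *
    have h3 : 0 ≤ q a * (S - (1 - P)) := mul_nonneg (hq a).1 (by linarith)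
    have h4 : 0 ≤ (M - q a) * S := mul_nonneg (by linarith [hM a]) h0
    have h5 : 0 ≤ q a * (s.card * M - S) := mul_nonneg (hq a).1 (by linarith)
    nlinarith

/-- The approximation ratio of the cascade reward relative to the sum of the attraction
probabilities. -/
theorem max_mul_sum_le_one_sub_prod {K : ℕ} (hK : 1 ≤ K) (q : Fin K → ℝ)
    (hq : ∀ k, q k ∈ Set.Icc (0 : ℝ) 1) {M : ℝ} (hM : ∀ k, q k ≤ M) :
    max (1 / (K : ℝ)) (1 - ((K : ℝ) - 1) / 2 * M) * ∑ k, q k ≤ 1 - ∏ k, (1 - q k) := by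
  rcases max_choice (1 / (K : ℝ)) (1 - ((K : ℝ) - 1) / 2 * M) with h | h <;> rw [h]
  · have hK' : (0 : ℝ) < K := by exact_mod_cast hK
    rw [one_div_mul_eq_div, div_le_iff₀ hK']
    have h1 : ∀ k, q k ≤ 1 - ∏ k, (1 - q k) := by
      intro k
      have : ∏ k, (1 - q k) ≤ 1 - q k := by
        rw [← Finset.mul_prod_erase _ _ (Finset.mem_univ k)]
        exact mul_le_of_le_one_right (sub_nonneg.2 (hq k).2)
          (Finset.prod_le_one (fun i _ => sub_nonneg.2 (hq i).2) fun i _ => by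
            linarith [(hq i).1])
      linarith
    have := Finset.sum_le_card_nsmul Finset.univ q _ fun k _ => h1 k
    simpa [mul_comm] using this
  · simpa using sum_mul_le_one_sub_prod Finset.univ q hq hM

theorem sum_filter_lt_succ {K : ℕ} (q : Fin K → ℝ) (k : Fin K) :
    ∑ i ∈ firstPositions K (k + 1), q i = ∑ i ∈ firstPositions K k, q i + q k := by
  rw [firstPositions_succ, Finset.sum_insert (by simp [mem_firstPositions]), add_comm]

/-- The recursion behind the guarantee of the greedy algorithm: each increment covers at least
the fraction `1 / K` of the remaining gap to `F`. -/
theorem one_sub_exp_mul_le_sum {K : ℕ} (hK : 1 ≤ K) (q : Fin K → ℝ) {F : ℝ} (hF : 0 ≤ F)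
    (h : ∀ k : Fin K, F ≤ ∑ i ∈ firstPositions K k, q i + K * q k) :
    (1 - 1 / Real.exp 1) * F ≤ ∑ k, q k := by
  have hK' : (0 : ℝ) < K := by exact_mod_cast hK
  have hr : 0 ≤ 1 - 1 / (K : ℝ) := by
    rw [sub_nonneg, div_le_one hK']
    exact_mod_cast hK
  have hind : ∀ n ≤ K, F - ∑ i ∈ firstPositions K n, q i ≤ (1 - 1 / (K : ℝ)) ^ n * F := by
    intro n
    induction n with
    | zero => simp [firstPositions]
    | succ n ih =>
      intro hn
      have h1 := ih (by omega)
      have h2 := h ⟨n, hn⟩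
      have h3 := sum_filter_lt_succ q ⟨n, hn⟩
      simp only at h2 h3
      rw [h3, pow_succ]
      have h4 : (F - ∑ i ∈ firstPositions K n, q i) / K ≤ q ⟨n, hn⟩ := by
        rw [div_le_iff₀ hK']
        linarith
      have h5 := mul_le_mul_of_nonneg_left h1 hr
      calc _ ≤ (1 - 1 / (K : ℝ)) * (F - ∑ i ∈ firstPositions K n, q i) := by
            rw [sub_mul, one_mul, one_div_mul_eq_div]
            linarith
        _ ≤ _ := h5.trans (le_of_eq (by ring))
  have h1 := hind K le_rfl
  have h2 : (1 - 1 / (K : ℝ)) ^ K ≤ Real.exp (-1) :=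
    Real.one_sub_div_pow_le_exp_neg (by exact_mod_cast hK)
  rw [firstPositions_self] at h1
  rw [one_div, ← Real.exp_neg]
  nlinarith

section Utility

variable {L m d : ℕ} (x : Fin L → Fin d → ℝ) (z : Fin L → Fin m → ℝ) (θ : Fin d → ℝ)
  (β : Fin m → ℝ)

/-- The total utility of a set of items, whose marginal values are the attraction
probabilities. -/
def utility (S : Finset (Fin L)) : ℝ :=
  ∑ a ∈ S, z a ⬝ᵥ β + ∑ j, θ j * coverage x S j

theorem utility_empty : utility x z θ β ∅ = 0 := by
  simp [utility, coverage]

theorem gain_dotProduct (S : Finset (Fin L)) (a : Fin L) :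
    gain x S a ⬝ᵥ θ = ∑ j, θ j * coverage x (insert a S) j - ∑ j, θ j * coverage x S j := by
  rw [← Finset.sum_sub_distrib]
  exact Finset.sum_congr rfl fun j _ => by rw [gain]; ring

theorem utility_insert {S : Finset (Fin L)} {a : Fin L} (ha : a ∉ S) :
    utility x z θ β (insert a S) = utility x z θ β S + attraction x z θ β S a := by
  rw [utility, utility, attraction, gain_dotProduct, Finset.sum_insert ha]
  ring

theorem sum_attraction_eq_utility {K : ℕ} (R : Fin K ↪ Fin L) (k : ℕ) (hk : k ≤ K) :
    ∑ i ∈ firstPositions K k, attraction x z θ β (above R i) (R i) =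
      utility x z θ β (firstItems R k) := by
  induction k with
  | zero => simp [firstPositions, firstItems_zero, utility_empty]
  | succ k ih =>
    have h1 := sum_filter_lt_succ (fun i => attraction x z θ β (above R i) (R i)) ⟨k, hk⟩
    have h2 := firstItems_succ R ⟨k, hk⟩
    have h3 := firstItems_eq_above R ⟨k, hk⟩
    simp only at h1 h2 h3
    rw [h1, ih (by omega), h2, utility_insert x z θ β (notMem_above R _), h3]

variable {x z θ β}

theorem attraction_anti
    (hsub : IsSubmodular (fun S : Finset (Fin L) => ∑ j, θ j * coverage x S j))
    {S T : Finset (Fin L)} (hST : S ⊆ T) {a : Fin L} (ha : a ∉ T) :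
    attraction x z θ β T a ≤ attraction x z θ β S a := by
  have := hsub T S hST a ha
  rw [attraction, attraction, gain_dotProduct, gain_dotProduct]
  linarith

theorem utility_le_utility_union
    (hα : ∀ (S : Finset (Fin L)) (a : Fin L), a ∉ S →
      attraction x z θ β S a ∈ Set.Icc (0 : ℝ) 1) (S T : Finset (Fin L)) :
    utility x z θ β T ≤ utility x z θ β (T ∪ S) := by
  induction S using Finset.induction_on with
  | empty => simp
  | insert a S _ ih =>
    rw [Finset.union_insert]
    by_cases h : a ∈ T ∪ S
    · rwa [Finset.insert_eq_of_mem h]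
    · rw [utility_insert x z θ β h]
      linarith [(hα _ _ h).1]

theorem utility_union_le
    (hsub : IsSubmodular (fun S : Finset (Fin L) => ∑ j, θ j * coverage x S j))
    (S T : Finset (Fin L)) {v : ℝ} (hv0 : 0 ≤ v)
    (hv : ∀ a ∉ S, attraction x z θ β S a ≤ v) :
    utility x z θ β (S ∪ T) ≤ utility x z θ β S + T.card * v := by
  induction T using Finset.induction_on with
  | empty => simp
  | insert a T haT ih =>
    rw [Finset.union_insert, Finset.card_insert_of_notMem haT]
    push_cast
    by_cases h : a ∈ S ∪ T
    · rw [Finset.insert_eq_of_mem h]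
      linarith
    · rw [utility_insert x z θ β h]
      have h1 : attraction x z θ β (S ∪ T) a ≤ attraction x z θ β S a :=
        attraction_anti hsub Finset.subset_union_left h
      have h2 := hv a fun h' => h (Finset.mem_union_left _ h')
      linarith

theorem attraction_le_alphaMax
    (hsub : IsSubmodular (fun S : Finset (Fin L) => ∑ j, θ j * coverage x S j))
    {S : Finset (Fin L)} {a : Fin L} (ha : a ∉ S) :
    attraction x z θ β S a ≤ alphaMax x z θ β := by
  refine (attraction_anti hsub (Finset.empty_subset S) ha).trans ?_
  have h : attraction x z θ β ∅ a = z a ⬝ᵥ β + x a ⬝ᵥ θ := by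
    rw [attraction]
    congr 2
    funext j
    rw [gain_apply (Finset.notMem_empty a)]
    simp
  rw [h]
  exact le_ciSup (f := fun a => z a ⬝ᵥ β + x a ⬝ᵥ θ) (Set.finite_range _).bddAbove a

variable {K : ℕ}

theorem expectedReward_mem_Icc
    (hα : ∀ (S : Finset (Fin L)) (a : Fin L), a ∉ S →
      attraction x z θ β S a ∈ Set.Icc (0 : ℝ) 1) (R : Fin K ↪ Fin L) :
    expectedReward x z θ β R ∈ Set.Icc (0 : ℝ) 1 := by
  have h := fun k => hα _ _ (notMem_above R k)
  have h1 := Finset.prod_le_one (s := Finset.univ)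
    (f := fun k => 1 - attraction x z θ β (above R k) (R k))
    (fun k _ => sub_nonneg.2 (h k).2) fun k _ => by linarith [(h k).1]
  have h0 := Finset.prod_nonneg (s := Finset.univ)
    (f := fun k => 1 - attraction x z θ β (above R k) (R k)) fun k _ => sub_nonneg.2 (h k).2
  rw [expectedReward]
  constructor <;> linarith

theorem one_sub_one_div_exp_mem_Icc : 1 - 1 / Real.exp 1 ∈ Set.Icc (0 : ℝ) 1 := by
  have h1 : 1 / Real.exp 1 ≤ 1 := by
    rw [div_le_one (Real.exp_pos 1)]
    exact Real.one_le_exp zero_le_one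
  have h2 : 0 ≤ 1 / Real.exp 1 := by positivity
  constructor <;> linarith

theorem eta_mul_optimalReward_le_one (hK : 1 ≤ K) (hKL : K ≤ L)
    (hα : ∀ (S : Finset (Fin L)) (a : Fin L), a ∉ S →
      attraction x z θ β S a ∈ Set.Icc (0 : ℝ) 1)
    (hsub : IsSubmodular (fun S : Finset (Fin L) => ∑ j, θ j * coverage x S j)) :
    eta K x z θ β * optimalReward K x z θ β ≤ 1 := by
  have hK1 : (1 : ℝ) ≤ K := by exact_mod_cast hK
  have hmax : 0 ≤ alphaMax x z θ β :=
    (hα ∅ (⟨0, by omega⟩ : Fin L) (Finset.notMem_empty _)).1.trans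
      (attraction_le_alphaMax hsub (Finset.notMem_empty _))
  have h1 : max (1 / (K : ℝ)) (1 - ((K : ℝ) - 1) / 2 * alphaMax x z θ β) ≤ 1 := by
    refine max_le ((div_le_one (by linarith)).2 hK1) ?_
    have : 0 ≤ ((K : ℝ) - 1) / 2 * alphaMax x z θ β := mul_nonneg (by linarith) hmax
    linarith
  have h2 : 0 ≤ max (1 / (K : ℝ)) (1 - ((K : ℝ) - 1) / 2 * alphaMax x z θ β) :=
    le_max_of_le_left (by positivity)
  have : Nonempty (Fin K ↪ Fin L) := ⟨Fin.castLEEmb hKL⟩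
  have h3 : optimalReward K x z θ β ≤ 1 := ciSup_le fun R => (expectedReward_mem_Icc hα R).2
  have h4 : eta K x z θ β ≤ 1 :=
    mul_le_one₀ one_sub_one_div_exp_mem_Icc.2 h2 h1
  have h5 : 0 ≤ eta K x z θ β := mul_nonneg one_sub_one_div_exp_mem_Icc.1 h2
  have h6 : 0 ≤ optimalReward K x z θ β := Real.iSup_nonneg fun R => (expectedReward_mem_Icc hα R).1
  exact mul_le_one₀ h4 h6 h3

/-- The regret of an approximately greedy list: if position `k` misses the best available
attraction probability by at most `e k`, then the scaled regret of the list is at most the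
expected total of `e` over the observed positions, truncated at `1`. -/
theorem eta_mul_optimalReward_sub_le (hK : 1 ≤ K)
    (hα : ∀ (S : Finset (Fin L)) (a : Fin L), a ∉ S →
      attraction x z θ β S a ∈ Set.Icc (0 : ℝ) 1)
    (hsub : IsSubmodular (fun S : Finset (Fin L) => ∑ j, θ j * coverage x S j))
    (R : Fin K ↪ Fin L) (e : Fin K → ℝ)
    (he : ∀ k, ∀ a, a ∉ above R k →
      attraction x z θ β (above R k) a - attraction x z θ β (above R k) (R k) ≤ e k) :
    eta K x z θ β * optimalReward K x z θ β - expectedReward x z θ β R ≤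
      ∑ b, patternProb (fun k => attraction x z θ β (above R k) (R k)) b *
        min 1 (∑ k ∈ observed K (firstTrue b), e k) := by
  have hbest : ∀ k, ∃ a, a ∉ above R k ∧ ∀ a', a' ∉ above R k →
      attraction x z θ β (above R k) a' ≤ attraction x z θ β (above R k) a := by
    intro k
    obtain ⟨a, ha, hmax⟩ := Finset.exists_max_image (above R k)ᶜ
      (attraction x z θ β (above R k)) ⟨R k, Finset.mem_compl.2 (notMem_above R k)⟩
    exact ⟨a, Finset.mem_compl.1 ha, fun a' ha' => hmax a' (Finset.mem_compl.2 ha')⟩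
  choose g hg hgmax using hbest
  -- `q` is optimistic but is attached to the sets of items chosen by `R`, whose utility grows by
  -- `p ≤ q`; hence the greedy recursion still applies to the partial sums of `q`.
  set p : Fin K → ℝ := fun k => attraction x z θ β (above R k) (R k) with hp
  set q : Fin K → ℝ := fun k => attraction x z θ β (above R k) (g k) with hqdef
  have hp01 : ∀ k, p k ∈ Set.Icc (0 : ℝ) 1 := fun k => hα _ _ (notMem_above R k)
  have hq01 : ∀ k, q k ∈ Set.Icc (0 : ℝ) 1 := fun k => hα _ _ (hg k)
  have hpq : ∀ k, p k ≤ q k := fun k => hgmax k _ (notMem_above R k)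
  refine le_trans ?_ (prod_sub_prod_le_sum_patternProb (p := p) (q := q) (e := e)
    (fun k => (hp01 k).1) hpq (fun k => (hq01 k).2) fun k => he k _ (hg k))
  have : Nonempty (Fin K ↪ Fin L) := ⟨R⟩
  obtain ⟨Rs, hRs⟩ := exists_eq_ciSup_of_finite (f := fun R : Fin K ↪ Fin L =>
    expectedReward x z θ β R)
  set F := utility x z θ β (firstItems Rs K) with hFdef
  have hsum : ∑ k, attraction x z θ β (above Rs k) (Rs k) = F := by
    rw [hFdef, ← sum_attraction_eq_utility x z θ β Rs K le_rfl, firstPositions_self]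
  have hF0 : 0 ≤ F := by
    rw [← hsum]
    exact Finset.sum_nonneg fun k _ => (hα _ _ (notMem_above Rs k)).1
  have hopt : optimalReward K x z θ β ≤ F := by
    rw [optimalReward, ← hRs, ← hsum]
    exact one_sub_prod_le_sum Finset.univ _ fun k => hα _ _ (notMem_above Rs k)
  have hgreedy : ∀ k : Fin K, F ≤ ∑ i ∈ firstPositions K k, q i + K * q k := by
    intro k
    have h1 := utility_le_utility_union hα (above R k) (firstItems Rs K)
    have h2 := utility_union_le hsub (above R k) (firstItems Rs K) (hq01 k).1 (hgmax k)
    have h3 : (firstItems Rs K).card = K := by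
      simp [firstItems, firstPositions_self]
    have h4 : utility x z θ β (above R k) ≤ ∑ i ∈ firstPositions K k, q i := by
      rw [← firstItems_eq_above, ← sum_attraction_eq_utility x z θ β R k k.2.le]
      exact Finset.sum_le_sum fun i _ => hpq i
    rw [h3, Finset.union_comm] at h2
    linarith
  have h5 := one_sub_exp_mul_le_sum hK q hF0 hgreedy
  have h6 := max_mul_sum_le_one_sub_prod hK q hq01 (M := alphaMax x z θ β)
    fun k => attraction_le_alphaMax hsub (hg k)
  set c := max (1 / (K : ℝ)) (1 - ((K : ℝ) - 1) / 2 * alphaMax x z θ β) with hc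
  have hc0 : 0 ≤ c := le_max_of_le_left (by positivity)
  have h7 : eta K x z θ β * optimalReward K x z θ β ≤ 1 - ∏ k, (1 - q k) := by
    refine le_trans ?_ h6
    rw [eta, ← hc, mul_comm (1 - 1 / Real.exp 1), mul_assoc]
    refine mul_le_mul_of_nonneg_left (le_trans ?_ h5) hc0
    exact mul_le_mul_of_nonneg_left hopt one_sub_one_div_exp_mem_Icc.1
  rw [expectedReward]
  linarith

end Utility

/-! ### Random elements with finitely many values -/

/-- The function `f` is measurable with respect to `𝓕` and takes finitely many values. The
displayed lists, the feedback and therefore all statistics of a run have this property, which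
is stable under composition with arbitrary functions. -/
def FinMeas {Ω β : Type*} (𝓕 : MeasurableSpace Ω) (f : Ω → β) : Prop :=
  (∀ y, MeasurableSet[𝓕] (f ⁻¹' {y})) ∧ (Set.range f).Finite

namespace FinMeas

variable {Ω β β' : Type*} {𝓕 𝓖 : MeasurableSpace Ω} {f : Ω → β}

theorem measurableSet (hf : FinMeas 𝓕 f) (P : β → Prop) : MeasurableSet[𝓕] {ω | P (f ω)} := by
  have : {ω | P (f ω)} = ⋃ y ∈ {y ∈ Set.range f | P y}, f ⁻¹' {y} := by
    ext ω
    simp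
  rw [this]
  exact (hf.2.subset (Set.sep_subset _ _)).measurableSet_biUnion fun y _ => hf.1 y

theorem comp (hf : FinMeas 𝓕 f) (g : β → β') : FinMeas 𝓕 fun ω => g (f ω) :=
  ⟨fun y => hf.measurableSet fun v => g v = y, by
    have := hf.2.image g
    rwa [← Set.range_comp] at this⟩

theorem prodMk {g : Ω → β'} (hf : FinMeas 𝓕 f) (hg : FinMeas 𝓕 g) :
    FinMeas 𝓕 fun ω => (f ω, g ω) := by
  refine ⟨fun y => ?_, (hf.2.prod hg.2).subset ?_⟩
  · have : (fun ω => (f ω, g ω)) ⁻¹' {y} = f ⁻¹' {y.1} ∩ g ⁻¹' {y.2} := by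
      ext ω
      simp [Prod.ext_iff]
    rw [this]
    exact (hf.1 _).inter (hg.1 _)
  · rintro _ ⟨ω, rfl⟩
    exact ⟨⟨ω, rfl⟩, ⟨ω, rfl⟩⟩

theorem mono (hf : FinMeas 𝓕 f) (h : 𝓕 ≤ 𝓖) : FinMeas 𝓖 f :=
  ⟨fun y => h _ (hf.1 y), hf.2⟩

theorem const (y : β) : FinMeas 𝓕 fun _ : Ω => y :=
  ⟨fun _ => MeasurableSet.const _, Set.finite_range_const⟩

theorem pi_of_measurable {κ γ : Type*} [Finite κ] [Finite γ] [MeasurableSpace γ]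
    [MeasurableSingletonClass γ] {f : Ω → κ → γ} (hf : ∀ k, Measurable[𝓕] fun ω => f ω k) :
    FinMeas 𝓕 f := by
  refine ⟨fun y => ?_, Set.toFinite _⟩
  have : f ⁻¹' {y} = ⋂ k, (fun ω => f ω k) ⁻¹' {y k} := by
    ext ω
    simp [funext_iff]
  rw [this]
  exact MeasurableSet.iInter fun k => hf k (measurableSet_singleton _)

theorem measurable [MeasurableSpace β] (hf : FinMeas 𝓕 f) : Measurable[𝓕] f :=
  fun s _ => hf.measurableSet fun y => y ∈ s

theorem integrable [mΩ : MeasurableSpace Ω] {μ : Measure Ω} [IsFiniteMeasure μ] {f : Ω → ℝ}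
    (hf : FinMeas 𝓕 f) (h : 𝓕 ≤ mΩ) : Integrable f μ := by
  obtain ⟨C, hC⟩ := (hf.2.image norm).bddAbove
  exact Integrable.of_bound (hf.mono h).measurable.aestronglyMeasurable C
    (Filter.Eventually.of_forall fun ω => hC ⟨f ω, ⟨ω, rfl⟩, rfl⟩)

end FinMeas

/-! ### The law of the feedback and the confidence ellipsoid -/

section Run

variable {L K m d : ℕ} (x : Fin L → Fin d → ℝ) (z : Fin L → Fin m → ℝ)
    (θ : Fin d → ℝ) (β : Fin m → ℝ) {Ω : Type*}

/-- The attraction indicators of the list `R`, by position. -/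
def pattern (R : Fin K ↪ Fin L) (A : Fin L → Bool) (k : Fin K) : Bool :=
  A (R k)

theorem click_eq_firstTrue (R : Fin K ↪ Fin L) (A : Fin L → Bool) :
    click R A = firstTrue (pattern R A) := rfl

theorem reward_eq (R : Fin K ↪ Fin L) (A : Fin L → Bool) :
    reward R A = 1 - ∏ k, (1 - if pattern R A k = true then (1 : ℝ) else 0) := rfl

/-- The attraction probabilities along the list `R`. -/
def listAttraction (R : Fin K ↪ Fin L) (k : Fin K) : ℝ :=
  attraction x z θ β (above R k) (R k)

/-- The statistics before step `t` of a run. -/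
noncomputable def runStats (R : ℕ → Ω → Fin K ↪ Fin L) (A : ℕ → Ω → Fin L → Bool) (t : ℕ)
    (ω : Ω) : Stats m d :=
  Stats.atTime x z (fun s => R s ω) (fun s => click (R s ω) (A s ω)) t

variable {x z θ β} {γ : ℝ} {n : ℕ} [mΩ : MeasurableSpace Ω] {μ : Measure Ω} {ℱ : Filtration ℕ mΩ}
  {R : ℕ → Ω → Fin K ↪ Fin L} {A : ℕ → Ω → Fin L → Bool}

theorem IsRun.finMeas_list (h : IsRun x z θ β γ n μ ℱ R A) {t : ℕ} (ht : t < n) :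
    FinMeas (ℱ t) (R t) := by
  have h1 : FinMeas (ℱ t) fun ω => (R t ω : Fin K → Fin L) :=
    FinMeas.pi_of_measurable fun k => h.measurable_list t ht k
  refine ⟨fun r => ?_, Set.toFinite _⟩
  have := h1.1 r
  convert this using 1
  ext ω
  simp

theorem IsRun.finMeas_pattern (h : IsRun x z θ β γ n μ ℱ R A) {t : ℕ} (ht : t < n) :
    FinMeas (ℱ (t + 1)) fun ω => pattern (R t ω) (A t ω) :=
  (((h.finMeas_list ht).mono (ℱ.mono t.le_succ)).prodMk
    (FinMeas.pi_of_measurable fun a => h.measurable_attraction t ht a)).comp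
    fun y => pattern y.1 y.2

theorem IsRun.finMeas_runStats (h : IsRun x z θ β γ n μ ℱ R A) {t : ℕ} (ht : t ≤ n) :
    FinMeas (ℱ t) (runStats x z R A t) := by
  induction t with
  | zero => exact FinMeas.const _
  | succ t ih =>
    have h1 := (ih (by omega)).mono (ℱ.mono t.le_succ)
    have h2 := (h.finMeas_list ht).mono (ℱ.mono t.le_succ)
    exact ((h1.prodMk h2).prodMk (h.finMeas_pattern ht)).comp
      fun y => Stats.update x z y.1.1 y.1.2 (firstTrue y.2)

/-- Averaging over the feedback of step `t`, given the past and the displayed list. -/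
theorem IsRun.integral_feedback [IsProbabilityMeasure μ] (h : IsRun x z θ β γ n μ ℱ R A) {t : ℕ}
    (ht : t < n) {G : Ω → (Fin K → Bool) → ℝ} (hG : FinMeas (ℱ t) G) :
    ∫ ω, G ω (pattern (R t ω) (A t ω)) ∂μ =
      ∫ ω, ∑ b, patternProb (listAttraction x z θ β (R t ω)) b * G ω b ∂μ := by
  have hle : ℱ t ≤ mΩ := ℱ.le t
  have hpat := h.finMeas_pattern ht
  have hlist := h.finMeas_list ht
  let I : (Fin K → Bool) → Ω → ℝ := fun b =>
    Set.indicator {ω | ∀ k, A t ω (R t ω k) = b k} fun _ => (1 : ℝ)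
  have hI : ∀ b ω, I b ω = if pattern (R t ω) (A t ω) = b then 1 else 0 := by
    intro b ω
    simp [I, Set.indicator_apply, funext_iff, pattern]
  have hIm : ∀ b, FinMeas (ℱ (t + 1)) (I b) := by
    intro b
    have := hpat.comp fun y => if y = b then (1 : ℝ) else 0
    convert this using 1
    funext ω
    exact hI b ω
  have hGm : ∀ b, FinMeas (ℱ t) fun ω => G ω b := fun b => hG.comp fun g => g b
  have hGI : ∀ b, Integrable ((fun ω => G ω b) * I b) μ := fun b =>
    ((((hGm b).mono (ℱ.mono t.le_succ)).prodMk (hIm b)).comp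
      fun y : ℝ × ℝ => y.1 * y.2).integrable (ℱ.le (t + 1))
  have h1 : ∀ ω, G ω (pattern (R t ω) (A t ω)) = ∑ b, ((fun ω => G ω b) * I b) ω := by
    intro ω
    simp [hI]
  simp only [h1]
  rw [integral_finsetSum _ fun b _ => hGI b, integral_finsetSum]
  · refine Finset.sum_congr rfl fun b _ => ?_
    rw [← integral_condExp hle]
    refine integral_congr_ae ?_
    filter_upwards [condExp_mul_of_stronglyMeasurable_left
      (hGm b).measurable.stronglyMeasurable (hGI b) ((hIm b).integrable (ℱ.le (t + 1))),
      h.law t ht b] with ω h2 h3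
    rw [h2, Pi.mul_apply, h3, mul_comm]
    rfl
  · intro b _
    exact ((hlist.prodMk (hGm b)).comp fun y : (Fin K ↪ Fin L) × ℝ =>
      patternProb (listAttraction x z θ β y.1) b * y.2).integrable hle

/-- The exponent of the exponential supermartingale in direction `l`. -/
noncomputable def Stats.logMartingale (s : Stats m d) (w l : Fin d ⊕ Fin m → ℝ) : ℝ :=
  l ⬝ᵥ s.noise w - l ⬝ᵥ ((s.gram - 1) *ᵥ l) / 8

/-- The contribution of the observed position `k` with outcome `b` to the exponent. -/
noncomputable def logIncrement (x : Fin L → Fin d → ℝ) (z : Fin L → Fin m → ℝ)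
    (w l : Fin d ⊕ Fin m → ℝ) (R : Fin K ↪ Fin L) (k : Fin K) (b : Bool) : ℝ :=
  l ⬝ᵥ listFeature x z R k * ((if b = true then 1 else 0) - listFeature x z R k ⬝ᵥ w) -
    (l ⬝ᵥ listFeature x z R k) ^ 2 / 8

theorem logMartingale_update (s : Stats m d) (w l : Fin d ⊕ Fin m → ℝ) (r : Fin K ↪ Fin L)
    (b : Fin K → Bool) :
    (Stats.update x z s r (firstTrue b)).logMartingale w l =
      s.logMartingale w l +
        ∑ k ∈ observed K (firstTrue b), logIncrement x z w l r k (b k) := by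
  have hv : ∀ (φ v : Fin d ⊕ Fin m → ℝ), vecMulVec φ φ *ᵥ v = (φ ⬝ᵥ v) • φ := by
    intro φ v
    rw [vecMulVec_mulVec]
    simp
  have hsum : ∀ v : Fin d ⊕ Fin m → ℝ,
      ((Stats.update x z s r (firstTrue b)).gram - 1) *ᵥ v = (s.gram - 1) *ᵥ v +
        ∑ k ∈ observed K (firstTrue b), (listFeature x z r k ⬝ᵥ v) • listFeature x z r k := by
    intro v
    rw [Stats.gram_update, add_sub_right_comm, add_mulVec, sum_mulVec]
    simp only [hv]
  rw [Stats.logMartingale, Stats.noise, hsum, hsum, Stats.response_update,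
    ← sum_observed_indicator b fun k => listFeature x z r k, Stats.logMartingale, Stats.noise]
  simp only [dotProduct_add, dotProduct_sub, dotProduct_sum, dotProduct_smul, smul_eq_mul,
    logIncrement, Finset.sum_sub_distrib, mul_sub, ← Finset.sum_div]
  have h1 : ∀ k, listFeature x z r k ⬝ᵥ l * (l ⬝ᵥ listFeature x z r k) =
      (l ⬝ᵥ listFeature x z r k) ^ 2 := by
    intro k
    rw [dotProduct_comm _ l, sq]
  simp only [h1, mul_comm (l ⬝ᵥ listFeature x z r _)]
  ring

/-- The exponential supermartingale bound: each observed indicator is sub-Gaussian with variance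
proxy `1 / 4` around its mean. -/
theorem IsRun.integral_exp_logMartingale_le [IsProbabilityMeasure μ]
    (h : IsRun x z θ β γ n μ ℱ R A)
    (hα : ∀ (S : Finset (Fin L)) (a : Fin L), a ∉ S →
      attraction x z θ β S a ∈ Set.Icc (0 : ℝ) 1) (l : Fin d ⊕ Fin m → ℝ) {t : ℕ} (ht : t ≤ n) :
    ∫ ω, Real.exp ((runStats x z R A t ω).logMartingale (Sum.elim θ β) l) ∂μ ≤ 1 := by
  induction t with
  | zero =>
    simp [runStats, Stats.atTime, Stats.logMartingale, Stats.noise_init, Stats.gram_init]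
  | succ t ih =>
    set w := Sum.elim θ β with hw
    let G : Ω → (Fin K → Bool) → ℝ := fun ω b =>
      Real.exp ((runStats x z R A t ω).logMartingale w l) *
        Real.exp (∑ k ∈ observed K (firstTrue b), logIncrement x z w l (R t ω) k (b k))
    have hstats := h.finMeas_runStats (t := t) (by omega)
    have hG : FinMeas (ℱ t) G :=
      (hstats.prodMk (h.finMeas_list ht)).comp
        fun y b => Real.exp (y.1.logMartingale w l) *
          Real.exp (∑ k ∈ observed K (firstTrue b), logIncrement x z w l y.2 k (b k))
    have h1 : ∀ ω, Real.exp ((runStats x z R A (t + 1) ω).logMartingale w l) =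
        G ω (pattern (R t ω) (A t ω)) := by
      intro ω
      rw [runStats, Stats.atTime, click_eq_firstTrue, logMartingale_update, Real.exp_add]
      rfl
    simp only [h1]
    rw [h.integral_feedback ht hG]
    refine le_trans (integral_mono ?_ ?_ fun ω => ?_) (ih (by omega))
    · exact ((hG.prodMk (h.finMeas_list ht)).comp fun y =>
        ∑ b, patternProb (listAttraction x z θ β y.2) b * y.1 b).integrable (ℱ.le t)
    · exact (hstats.comp fun s => Real.exp (s.logMartingale w l)).integrable (ℱ.le t)
    · simp only [G, mul_left_comm _ (Real.exp ((runStats x z R A t ω).logMartingale w l))]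
      rw [← Finset.mul_sum]
      refine mul_le_of_le_one_right (Real.exp_nonneg _) ?_
      have hp : ∀ k, listAttraction x z θ β (R t ω) k ∈ Set.Icc (0 : ℝ) 1 :=
        fun k => hα _ _ (notMem_above _ k)
      refine sum_patternProb_mul_exp_le_one hp _ fun k => ?_
      have := bernoulli_exp_le_one (hp k) (l ⬝ᵥ listFeature x z (R t ω) k)
      have h2 : listFeature x z (R t ω) k ⬝ᵥ w = listAttraction x z θ β (R t ω) k :=
        (attraction_eq_feature_dotProduct x z θ β _ _).symm
      simpa [logIncrement, h2] using this

/-- The method of mixtures: integrating the supermartingale over a Gaussian direction bounds the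
exponential moment of the self-normalized noise. -/
theorem IsRun.lintegral_exp_noise_le [IsProbabilityMeasure μ]
    (h : IsRun x z θ β γ n μ ℱ R A)
    (hα : ∀ (S : Finset (Fin L)) (a : Fin L), a ∉ S →
      attraction x z θ β S a ∈ Set.Icc (0 : ℝ) 1) {t : ℕ} (ht : t ≤ n) :
    ∫⁻ ω, ENNReal.ofReal (Real.exp (2 * ((runStats x z R A t ω).noise (Sum.elim θ β) ⬝ᵥ
      ((runStats x z R A t ω).gram⁻¹ *ᵥ (runStats x z R A t ω).noise (Sum.elim θ β))) -
        Real.log (runStats x z R A t ω).gram.det / 2)) ∂μ ≤ 1 := by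
  set w := Sum.elim θ β with hw
  have hstats := h.finMeas_runStats ht
  set Z := ∫⁻ l : Fin d ⊕ Fin m → ℝ, ENNReal.ofReal (Real.exp (-(l ⬝ᵥ l) / 8)) with hZ
  have hsplit : ∀ (s : Stats m d) (l : Fin d ⊕ Fin m → ℝ),
      ENNReal.ofReal (Real.exp (l ⬝ᵥ s.noise w - l ⬝ᵥ (s.gram *ᵥ l) / 8)) =
        ENNReal.ofReal (Real.exp (-(l ⬝ᵥ l) / 8)) *
          ENNReal.ofReal (Real.exp (s.logMartingale w l)) := by
    intro s l
    rw [← ENNReal.ofReal_mul (Real.exp_nonneg _), ← Real.exp_add, Stats.logMartingale, sub_mulVec,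
      one_mulVec, dotProduct_sub]
    congr 2
    ring
  have hN : Measurable fun ω => (runStats x z R A t ω).noise w :=
    ((hstats.comp fun s => s.noise w).mono (ℱ.le t)).measurable
  have hV : Measurable fun ω => (fun i j => (runStats x z R A t ω).gram i j :
      Fin d ⊕ Fin m → Fin d ⊕ Fin m → ℝ) :=
    ((hstats.comp fun s => (fun i j => s.gram i j : Fin d ⊕ Fin m → Fin d ⊕ Fin m → ℝ)).mono
      (ℱ.le t)).measurable
  have hjoint : Measurable fun y : Ω × (Fin d ⊕ Fin m → ℝ) =>
      ENNReal.ofReal (Real.exp (y.2 ⬝ᵥ (runStats x z R A t y.1).noise w -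
        y.2 ⬝ᵥ ((runStats x z R A t y.1).gram *ᵥ y.2) / 8)) := by
    have hN' : ∀ i, Measurable fun y : Ω × (Fin d ⊕ Fin m → ℝ) =>
        (runStats x z R A t y.1).noise w i := fun i =>
      (measurable_pi_iff.1 hN i).comp measurable_fst
    have hV' : ∀ i j, Measurable fun y : Ω × (Fin d ⊕ Fin m → ℝ) =>
        (runStats x z R A t y.1).gram i j := fun i j =>
      (measurable_pi_iff.1 (measurable_pi_iff.1 hV i) j).comp measurable_fst
    have hl : ∀ i, Measurable fun y : Ω × (Fin d ⊕ Fin m → ℝ) => y.2 i := fun i =>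
      (measurable_pi_apply i).comp measurable_snd
    simp only [dotProduct, mulVec]
    refine (Real.measurable_exp.comp (Measurable.sub ?_ (Measurable.div_const ?_ 8))).ennreal_ofReal
    · exact Finset.measurable_fun_sum _ fun i _ => (hl i).mul (hN' i)
    · exact Finset.measurable_fun_sum _ fun i _ => (hl i).mul
        (Finset.measurable_fun_sum _ fun j _ => (hV' i j).mul (hl j))
  have hswap : ∫⁻ ω, (∫⁻ l : Fin d ⊕ Fin m → ℝ, ENNReal.ofReal (Real.exp
      (l ⬝ᵥ (runStats x z R A t ω).noise w -
        l ⬝ᵥ ((runStats x z R A t ω).gram *ᵥ l) / 8))) ∂μ ≤ Z := by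
    rw [lintegral_lintegral_swap hjoint.aemeasurable]
    refine lintegral_mono fun l => ?_
    simp only [hsplit]
    have hfm := (hstats.comp fun s => Real.exp (s.logMartingale w l))
    rw [lintegral_const_mul _ ((hfm.mono (ℱ.le t)).measurable.ennreal_ofReal),
      ← ofReal_integral_eq_lintegral_ofReal (hfm.integrable (ℱ.le t))
        (Filter.Eventually.of_forall fun ω => Real.exp_nonneg _)]
    refine mul_le_of_le_one_right zero_le ?_
    rw [ENNReal.ofReal_le_one]
    exact h.integral_exp_logMartingale_le hα l ht
  have hcong : ∀ ω, ∫⁻ l : Fin d ⊕ Fin m → ℝ, ENNReal.ofReal (Real.exp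
      (l ⬝ᵥ (runStats x z R A t ω).noise w -
        l ⬝ᵥ ((runStats x z R A t ω).gram *ᵥ l) / 8)) = _ := fun ω =>
    lintegral_exp_quadratic (Stats.gram_atTime_posDef x z (fun s => R s ω)
      (fun s => click (R s ω) (A s ω)) t) ((runStats x z R A t ω).noise w)
  simp only [hcong] at hswap
  have hEm := (hstats.comp fun s => Real.exp (2 * (s.noise w ⬝ᵥ (s.gram⁻¹ *ᵥ s.noise w)) -
    Real.log s.gram.det / 2)).mono (ℱ.le t)
  rw [lintegral_mul_const _ (by exact hEm.measurable.ennreal_ofReal)] at hswap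
  have hZ0 : Z ≠ 0 := lintegral_exp_neg_sq_ne_zero
  have hZt : Z ≠ ⊤ := lintegral_exp_neg_sq_ne_top
  have hdiv := (ENNReal.le_div_iff_mul_le (Or.inl hZ0) (Or.inl hZt)).2 hswap
  rwa [ENNReal.div_self hZ0 hZt] at hdiv

/-- The confidence event at step `t`: the self-normalized noise is below its threshold. -/
def Stats.Confident (s : Stats m d) (w : Fin d ⊕ Fin m → ℝ) (n : ℕ) : Prop :=
  2 * (s.noise w ⬝ᵥ (s.gram⁻¹ *ᵥ s.noise w)) - Real.log s.gram.det / 2 < Real.log n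

theorem IsRun.measureReal_not_confident_le [IsProbabilityMeasure μ]
    (h : IsRun x z θ β γ n μ ℱ R A)
    (hα : ∀ (S : Finset (Fin L)) (a : Fin L), a ∉ S →
      attraction x z θ β S a ∈ Set.Icc (0 : ℝ) 1) (hn : 1 ≤ n) {t : ℕ} (ht : t ≤ n) :
    μ.real {ω | ¬ (runStats x z R A t ω).Confident (Sum.elim θ β) n} ≤ 1 / n := by
  set w := Sum.elim θ β with hw
  have hn' : (0 : ℝ) < n := by exact_mod_cast hn
  have hEm := ((h.finMeas_runStats ht).comp fun s => Real.exp (2 * (s.noise w ⬝ᵥ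
    (s.gram⁻¹ *ᵥ s.noise w)) - Real.log s.gram.det / 2)).mono (ℱ.le t)
  have h1 := mul_meas_ge_le_lintegral₀ (μ := μ) hEm.measurable.ennreal_ofReal.aemeasurable
    (ENNReal.ofReal n)
  have h2 := h1.trans (h.lintegral_exp_noise_le hα ht)
  have h3 : {ω | ¬ (runStats x z R A t ω).Confident w n} ⊆
      {ω | ENNReal.ofReal n ≤ ENNReal.ofReal (Real.exp (2 * ((runStats x z R A t ω).noise w ⬝ᵥ
        ((runStats x z R A t ω).gram⁻¹ *ᵥ (runStats x z R A t ω).noise w)) -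
          Real.log (runStats x z R A t ω).gram.det / 2))} := by
    intro ω hω
    simp only [Stats.Confident, not_lt, Set.mem_ofPred_eq] at hω ⊢
    refine ENNReal.ofReal_le_ofReal ?_
    rw [← Real.exp_log hn']
    exact Real.exp_le_exp.2 hω
  have h4 : ENNReal.ofReal n * μ {ω | ¬ (runStats x z R A t ω).Confident w n} ≤ 1 :=
    (by gcongr : _ ≤ _).trans h2
  have h5 := ENNReal.toReal_mono ENNReal.one_ne_top h4
  rw [ENNReal.toReal_mul, ENNReal.toReal_ofReal hn'.le, ENNReal.toReal_one] at h5
  rw [le_div_iff₀ hn', mul_comm]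
  exact h5

end Run

/-! ### The elliptical potential -/

section Potential

variable {L K m d : ℕ} {x : Fin L → Fin d → ℝ} {z : Fin L → Fin m → ℝ}

/-- The total squared confidence width of the positions of `R` that are observed when the click
is at position `c`. -/
noncomputable def Stats.observedWidth (x : Fin L → Fin d → ℝ) (z : Fin L → Fin m → ℝ)
    (s : Stats m d) (R : Fin K ↪ Fin L) (c : ℕ) : ℝ :=
  ∑ k ∈ observed K c, s.width (gain x (above R k) (R k)) (z (R k))

theorem Stats.width_nonneg {s : Stats m d} (hs : s.gram.PosDef) (ω : Fin d → ℝ)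
    (ζ : Fin m → ℝ) : 0 ≤ s.width ω ζ := by
  rw [Stats.width_eq hs]
  exact dotProduct_inv_mulVec_nonneg hs _

theorem Stats.observedWidth_nonneg {s : Stats m d} (hs : s.gram.PosDef) (R : Fin K ↪ Fin L)
    (c : ℕ) : 0 ≤ s.observedWidth x z R c :=
  Finset.sum_nonneg fun _ _ => Stats.width_nonneg hs _ _

theorem sum_log_one_add_observedWidth_le (R : ℕ → Fin K ↪ Fin L) (c : ℕ → ℕ) (n : ℕ) :
    ∑ t ∈ Finset.range n,
        Real.log (1 + (Stats.atTime x z R c t).observedWidth x z (R t) (c t)) ≤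
      Real.log (Stats.atTime x z R c n).gram.det := by
  induction n with
  | zero => simp [Stats.atTime, Stats.gram_init]
  | succ n ih =>
    rw [Finset.sum_range_succ]
    have hV := Stats.gram_atTime_posDef x z R c n
    have hW := Stats.observedWidth_nonneg (x := x) (z := z) hV (R n) (c n)
    have h := det_mul_one_add_sum_le hV (observed K (c n)) (listFeature x z (R n))
    have hW' : ∑ k ∈ observed K (c n), listFeature x z (R n) k ⬝ᵥ
        ((Stats.atTime x z R c n).gram⁻¹ *ᵥ listFeature x z (R n) k) =
        (Stats.atTime x z R c n).observedWidth x z (R n) (c n) :=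
      Finset.sum_congr rfl fun k _ => (Stats.width_eq hV _ _).symm
    rw [hW', ← Stats.gram_update] at h
    have h2 := Real.log_le_log (mul_pos hV.det_pos (by linarith)) h
    rw [Real.log_mul hV.det_pos.ne' (by linarith)] at h2
    rw [Stats.atTime]
    linarith

theorem log_det_gram_atTime_le (hx : ∀ a j, x a j ∈ Set.Icc (0 : ℝ) 1)
    (hz : ∀ a, ‖(WithLp.toLp 2 (z a) : EuclideanSpace ℝ (Fin m))‖ ≤ 1)
    (R : ℕ → Fin K ↪ Fin L) (c : ℕ → ℕ) {n t : ℕ} (ht : t ≤ n) (hD : (1 : ℝ) ≤ (m : ℝ) + d) :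
    Real.log (Stats.atTime x z R c t).gram.det ≤
      ((m : ℝ) + d) * Real.log (1 + n * K / ((m : ℝ) + d) + n) := by
  have hD0 : (m : ℝ) + d ≠ 0 := by linarith
  have hm : (0 : ℝ) ≤ m := Nat.cast_nonneg m
  have hd : (0 : ℝ) ≤ d := Nat.cast_nonneg d
  have hK : (0 : ℝ) ≤ K := Nat.cast_nonneg K
  have hn : (t : ℝ) ≤ n := by exact_mod_cast ht
  have hn0 : (0 : ℝ) ≤ n := Nat.cast_nonneg n
  have h := log_det_le (Stats.gram_atTime_posDef x z R c t)
    (τ := 1 + n * K / ((m : ℝ) + d) + n) (by positivity) (by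
      refine (trace_gram_atTime_le hx hz R c t).trans ?_
      have h1 : ((m : ℝ) + d) * (1 + n * K / ((m : ℝ) + d) + n) =
          (m + d) + n * K + (m + d) * n := by
        field_simp
      rw [Fintype.card_sum, Fintype.card_fin, Fintype.card_fin]
      push_cast
      rw [add_comm (d : ℝ) m, h1]
      have h2 : (t : ℝ) * (K + d) ≤ n * (K + d) := by gcongr
      nlinarith [mul_nonneg hm hn0])
  rw [Fintype.card_sum, Fintype.card_fin, Fintype.card_fin] at h
  push_cast at h
  rwa [add_comm (d : ℝ) m] at h

/-- A truncated term of the potential is controlled by its logarithm; the smaller the truncation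
level `1 / a`, the closer the constant is to `1`. -/
theorem min_one_sqrt_le {a W : ℝ} (ha : 0 < a) (hW : 0 ≤ W) :
    min 1 (√(a * W)) ≤ √(a * ((1 + 1 / (2 * a)) * Real.log (1 + W))) := by
  have hmono : ∀ v, 0 ≤ v → v ≤ 1 / a → v ≤ W →
      a * v ≤ a * ((1 + 1 / (2 * a)) * Real.log (1 + W)) := by
    intro v hv hva hvW
    refine mul_le_mul_of_nonneg_left ?_ ha.le
    have h1 := Real.le_log_one_add_of_nonneg hv
    rw [div_le_iff₀ (by linarith)] at h1
    have h2 : Real.log (1 + v) ≤ Real.log (1 + W) :=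
      Real.log_le_log (by linarith) (by linarith)
    have h3 : 0 ≤ Real.log (1 + v) := Real.log_nonneg (by linarith)
    have h4 : v / 2 ≤ 1 / (2 * a) := by
      rw [mul_comm, ← div_div]
      linarith
    calc v ≤ (1 + v / 2) * Real.log (1 + v) := by linarith
      _ ≤ _ := by gcongr
  rcases le_total W (1 / a) with h | h
  · exact (min_le_right _ _).trans (Real.sqrt_le_sqrt (hmono W hW h le_rfl))
  · refine (min_le_left _ _).trans (Real.le_sqrt_of_sq_le ?_)
    have := hmono (1 / a) (by positivity) le_rfl h
    rw [mul_one_div_cancel ha.ne'] at this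
    linarith

theorem sum_min_one_le {R : ℕ → Fin K ↪ Fin L} {c : ℕ → ℕ} {n : ℕ} {γ Λ : ℝ} (hγ : 0 < γ)
    (hK : 1 ≤ K)
    (hdet : (1 + 1 / (8 * γ ^ 2 * K)) * Real.log (Stats.atTime x z R c n).gram.det ≤ 2 * Λ) :
    ∑ t ∈ Finset.range n,
        min 1 (2 * γ * √(K * (Stats.atTime x z R c t).observedWidth x z (R t) (c t))) ≤
      2 * γ * √(2 * n * K * Λ) := by
  have hK' : (0 : ℝ) < K := by exact_mod_cast hK
  set W : ℕ → ℝ := fun t => (Stats.atTime x z R c t).observedWidth x z (R t) (c t) with hW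
  have hW0 : ∀ t, 0 ≤ W t := fun t =>
    Stats.observedWidth_nonneg (Stats.gram_atTime_posDef x z R c t) _ _
  have hpull : ∀ v : ℝ, 2 * γ * √v = √(4 * γ ^ 2 * v) := by
    intro v
    rw [Real.sqrt_mul (by positivity), show 4 * γ ^ 2 = (2 * γ) ^ 2 by ring,
      Real.sqrt_sq (by positivity)]
  set a := 4 * γ ^ 2 * K with ha
  have ha0 : 0 < a := by positivity
  have h1 : ∀ t, min 1 (2 * γ * √(K * W t)) ≤
      √(a * ((1 + 1 / (2 * a)) * Real.log (1 + W t))) := by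
    intro t
    rw [hpull, ← mul_assoc, ← ha]
    exact min_one_sqrt_le ha0 (hW0 t)
  have hlog : ∀ t, 0 ≤ Real.log (1 + W t) := fun t => Real.log_nonneg (by linarith [hW0 t])
  refine (Finset.sum_le_sum fun t _ => h1 t).trans ?_
  have h2 : (∑ t ∈ Finset.range n, √(a * ((1 + 1 / (2 * a)) * Real.log (1 + W t)))) ^ 2 ≤
      n * ∑ t ∈ Finset.range n, a * ((1 + 1 / (2 * a)) * Real.log (1 + W t)) := by
    refine sq_sum_le_card_mul_sum_sq.trans (le_of_eq ?_)
    rw [Finset.card_range]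
    congr 1
    refine Finset.sum_congr rfl fun t _ => Real.sq_sqrt ?_
    have := hlog t
    positivity
  rw [hpull]
  refine Real.le_sqrt_of_sq_le (h2.trans ?_)
  rw [← Finset.mul_sum, ← Finset.mul_sum]
  have h3 := sum_log_one_add_observedWidth_le (x := x) (z := z) R c n
  have h4 : (1 + 1 / (2 * a)) * ∑ t ∈ Finset.range n, Real.log (1 + W t) ≤ 2 * Λ := by
    refine le_trans ?_ hdet
    have : 2 * a = 8 * γ ^ 2 * K := by rw [ha]; ring
    rw [this]
    gcongr
  calc (n : ℝ) * (a * ((1 + 1 / (2 * a)) * ∑ t ∈ Finset.range n, Real.log (1 + W t)))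
      ≤ n * (a * (2 * Λ)) := by gcongr
    _ = 4 * γ ^ 2 * (2 * n * K * Λ) := by rw [ha]; ring

end Potential

/-! ### Numerical estimates -/

/-- If the regret bound is not trivial, that is, if it is smaller than `n`, then `n` is large
compared with `D ^ 2 * K`. This absorbs the feature norms, which may exceed `1`, and the constant
of the truncated potential. -/
theorem log_det_bound_of_nontrivial {D K n γ : ℝ} (hD : 1 ≤ D) (hK : 1 ≤ K) (hn : 1 ≤ n)
    (hγ : √(D * Real.log (1 + n * K / D)) ≤ γ)
    (hlt : 2 * γ * √(2 * n * K * D * Real.log (1 + n * K / D)) < n) :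
    (1 + 1 / (8 * γ ^ 2 * K)) * (D * Real.log (1 + n * K / D + n)) ≤
      2 * (D * Real.log (1 + n * K / D)) := by
  set q := n * K / D with hq
  have hqD : q * D = n * K := by rw [hq]; field_simp
  have hq0 : 0 < q := by positivity
  set l := Real.log (1 + q) with hl
  have hl0 : 0 < l := Real.log_pos (by linarith)
  have hlq := Real.le_log_one_add_of_nonneg hq0.le
  rw [← hl] at hlq
  have hγ2 : D * l ≤ γ ^ 2 := by
    rw [← Real.sq_sqrt (by positivity : 0 ≤ D * l)]
    exact pow_le_pow_left₀ (Real.sqrt_nonneg _) hγ 2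
  have hmain : 8 * K * (D * l) ^ 2 < n := by
    have h1 : √(D * l) * √(2 * n * K * D * l) = √(2 * n * K) * (D * l) := by
      rw [show 2 * n * K * D * l = (D * l) * (2 * n * K) by ring,
        Real.sqrt_mul (by positivity : 0 ≤ D * l), ← mul_assoc,
        Real.mul_self_sqrt (by positivity), mul_comm]
    have h2 : 2 * (√(2 * n * K) * (D * l)) < n := by
      refine lt_of_le_of_lt ?_ hlt
      rw [← h1, ← mul_assoc]
      gcongr
    have h3 := pow_lt_pow_left₀ h2 (by positivity) two_ne_zero
    rw [mul_pow, mul_pow, Real.sq_sqrt (by positivity)] at h3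
    nlinarith
  have hq1 : 1 ≤ q := by
    by_contra! hlt1
    have h1 : 2 / 3 * q ≤ l := by
      refine le_trans ?_ hlq
      rw [le_div_iff₀ (by linarith)]
      nlinarith
    have h2 : 2 / 3 * (n * K) ≤ D * l := by rw [← hqD]; nlinarith
    have h3 : (2 / 3 * (n * K)) ^ 2 ≤ (D * l) ^ 2 := pow_le_pow_left₀ (by positivity) h2 2
    have h4 : n ≤ n * K := by nlinarith
    have h5 : n * n ≤ (n * K) ^ 2 := by nlinarith
    nlinarith
  have hl23 : 2 / 3 ≤ l := by
    refine le_trans ?_ hlq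
    rw [le_div_iff₀ (by linarith)]
    linarith
  have hn2 : n ≤ 9 / 32 * q ^ 2 := by
    have h1 : 2 / 3 * D ≤ D * l := by nlinarith
    have h2 : (2 / 3 * D) ^ 2 ≤ (D * l) ^ 2 := pow_le_pow_left₀ (by positivity) h1 2
    have h3 : 32 / 9 * D ^ 2 * K ≤ n := by nlinarith
    have h4 : n ≤ n * K := by nlinarith
    have h5 : 32 / 9 * D ^ 2 ≤ q * D := by
      rw [hqD]
      nlinarith [sq_nonneg D]
    have h6 : 32 / 9 * D ≤ q := by nlinarith
    nlinarith
  have hbig : 4 / 3 * (1 + q + n) ≤ (1 + q) ^ 2 := by nlinarith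
  have h43 : 1 / 4 ≤ Real.log (4 / 3) := by
    have := Real.le_log_one_add_of_nonneg (x := 1 / 3) (by norm_num)
    norm_num at this ⊢
    linarith
  have hlog : Real.log (1 + q + n) + 1 / 4 ≤ 2 * l := by
    have h1 := Real.log_le_log (by positivity) hbig
    rw [Real.log_mul (by norm_num) (by positivity), Real.log_pow] at h1
    push_cast at h1
    linarith
  have hc : 1 / (8 * γ ^ 2 * K) ≤ 1 / (8 * l) := by
    apply one_div_le_one_div_of_le (by positivity)
    have : l ≤ γ ^ 2 := by nlinarith
    nlinarith
  have hL0 : 0 ≤ Real.log (1 + q + n) := Real.log_nonneg (by linarith)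
  have hlast : (1 + 1 / (8 * γ ^ 2 * K)) * Real.log (1 + q + n) ≤ 2 * l := by
    have h1 : 1 / (8 * γ ^ 2 * K) * Real.log (1 + q + n) ≤ 1 / (8 * l) * (2 * l) :=
      mul_le_mul hc (by linarith) hL0 (by positivity)
    have h2 : 1 / (8 * l) * (2 * l) = 1 / 4 := by field_simp; norm_num
    linarith
  calc _ = D * ((1 + 1 / (8 * γ ^ 2 * K)) * Real.log (1 + q + n)) := by ring
    _ ≤ D * (2 * l) := by gcongr
    _ = _ := by ring

theorem regret_bound_le_order {D K n ν : ℝ} (hD : 1 ≤ D) (hK : 1 ≤ K) (hn : 1 ≤ n)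
    (hν : ν ≤ 1) :
    2 * (√(D * Real.log (1 + n * K / D) + 2 * Real.log n) + ν) *
        √(2 * n * K * D * Real.log (1 + n * K / D)) + 1 ≤
      12 * (D * √(K * n) * Real.log (1 + n * K)) := by
  have hN : 1 ≤ n * K := by nlinarith
  set l := Real.log (1 + n * K) with hl
  have hl23 : 2 / 3 ≤ l := by
    refine le_trans ?_ (Real.le_log_one_add_of_nonneg (by linarith))
    rw [le_div_iff₀ (by linarith)]
    linarith
  have hle : Real.log (1 + n * K / D) ≤ l := by
    refine Real.log_le_log (by positivity) ?_
    gcongr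
    exact div_le_self (by linarith) hD
  have hlogn : Real.log n ≤ l := Real.log_le_log (by linarith) (by nlinarith)
  have hDl : 2 / 3 ≤ D * l := by nlinarith
  set v := D * l with hv
  have h1 : √(D * Real.log (1 + n * K / D) + 2 * Real.log n) ≤ √(3 * v) := by
    refine Real.sqrt_le_sqrt ?_
    have : D * Real.log (1 + n * K / D) ≤ D * l := by gcongr
    nlinarith
  have h2 : 1 ≤ √(3 * v) := Real.one_le_sqrt.2 (by linarith)
  have h3 : √(2 * n * K * D * Real.log (1 + n * K / D)) ≤ √(2 * v) * √(K * n) := by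
    rw [← Real.sqrt_mul (by linarith)]
    refine Real.sqrt_le_sqrt ?_
    calc 2 * n * K * D * Real.log (1 + n * K / D) ≤ 2 * n * K * D * l := by gcongr
      _ = _ := by rw [hv]; ring
  have h4 : √(3 * v) * √(2 * v) ≤ 5 / 2 * v := by
    rw [← Real.sqrt_mul (by linarith)]
    refine Real.sqrt_le_iff.2 ⟨by linarith, ?_⟩
    nlinarith [sq_nonneg v]
  have h5 : 1 ≤ √(K * n) := Real.one_le_sqrt.2 (by linarith)
  have h6 : 2 * (√(D * Real.log (1 + n * K / D) + 2 * Real.log n) + ν) *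
      √(2 * n * K * D * Real.log (1 + n * K / D)) ≤
      2 * (2 * √(3 * v)) * (√(2 * v) * √(K * n)) :=
    mul_le_mul (by linarith) h3 (Real.sqrt_nonneg _) (by positivity)
  have h7 : 2 * (2 * √(3 * v)) * (√(2 * v) * √(K * n)) ≤ 10 * (v * √(K * n)) := by
    have := mul_le_mul_of_nonneg_right h4 (Real.sqrt_nonneg (K * n))
    nlinarith
  have h8 : 2 / 3 ≤ v * √(K * n) := by nlinarith
  calc _ ≤ 12 * (v * √(K * n)) := by linarith
    _ = _ := by rw [hv]; ring

/-! ### The regret -/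

theorem paramNorm_eq {m d : ℕ} (θ : Fin d → ℝ) (β : Fin m → ℝ) :
    paramNorm θ β = √(Sum.elim θ β ⬝ᵥ Sum.elim θ β) := by
  rw [paramNorm, EuclideanSpace.norm_eq]
  congr 1
  simp [dotProduct, sq]

section Regret

variable {L K m d : ℕ} {x : Fin L → Fin d → ℝ} {z : Fin L → Fin m → ℝ}
    {θ : Fin d → ℝ} {β : Fin m → ℝ} {γ : ℝ} {n : ℕ}

/-- With accurate estimates, the list of maximizers of the upper confidence bound misses the best
attraction probability at each position by at most twice the confidence radius. -/
theorem attraction_sub_le_of_isChoice {s : Stats m d} (hs : (s.gram - 1).PosSemidef)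
    (hγ : √(s.noise (Sum.elim θ β) ⬝ᵥ (s.gram⁻¹ *ᵥ s.noise (Sum.elim θ β))) +
      √(Sum.elim θ β ⬝ᵥ Sum.elim θ β) ≤ γ) {R : Fin K ↪ Fin L} (hR : s.IsChoice x z γ R)
    (k : Fin K) {a : Fin L} (ha : a ∉ above R k) :
    attraction x z θ β (above R k) a - attraction x z θ β (above R k) (R k) ≤
      2 * γ * √(s.width (gain x (above R k) (R k)) (z (R k))) := by
  have h1 := abs_le.1 (Stats.abs_estimate_sub_le hs _ hγ (gain x (above R k) a) (z a))
  have h2 := abs_le.1 (Stats.abs_estimate_sub_le hs _ hγ (gain x (above R k) (R k)) (z (R k)))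
  have h3 := hR k a ha
  rw [Stats.ucb, Stats.ucb] at h3
  rw [attraction_eq_feature_dotProduct, attraction_eq_feature_dotProduct, feature, feature]
  linarith [h1.1, h2.2]

theorem sum_sqrt_width_le {s : Stats m d} (hs : s.gram.PosDef) (hγ : 0 ≤ γ) (R : Fin K ↪ Fin L)
    (c : ℕ) :
    ∑ k ∈ observed K c, 2 * γ * √(s.width (gain x (above R k) (R k)) (z (R k))) ≤
      2 * γ * √(K * s.observedWidth x z R c) := by
  rw [← Finset.mul_sum]
  refine mul_le_mul_of_nonneg_left (Real.le_sqrt_of_sq_le ?_) (by positivity)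
  refine sq_sum_le_card_mul_sum_sq.trans ?_
  have h1 : ∑ k ∈ observed K c, √(s.width (gain x (above R k) (R k)) (z (R k))) ^ 2 =
      s.observedWidth x z R c :=
    Finset.sum_congr rfl fun k _ => Real.sq_sqrt (Stats.width_nonneg hs _ _)
  rw [h1]
  have h2 : ((observed K c).card : ℝ) ≤ K := by
    exact_mod_cast (Finset.card_le_univ _).trans (by simp)
  exact mul_le_mul_of_nonneg_right h2 (Stats.observedWidth_nonneg hs R c)

variable {Ω : Type*} [mΩ : MeasurableSpace Ω] {μ : Measure Ω}
  {ℱ : Filtration ℕ mΩ} {R : ℕ → Ω → Fin K ↪ Fin L} {A : ℕ → Ω → Fin L → Bool}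

theorem IsRun.finMeas_reward (h : IsRun x z θ β γ n μ ℱ R A) {t : ℕ} (ht : t < n) :
    FinMeas (ℱ (t + 1)) fun ω => reward (R t ω) (A t ω) :=
  (h.finMeas_pattern ht).comp fun b => 1 - ∏ k, (1 - if b k = true then (1 : ℝ) else 0)

theorem reward_nonneg (r : Fin K ↪ Fin L) (a : Fin L → Bool) : 0 ≤ reward r a := by
  rw [reward, sub_nonneg]
  refine Finset.prod_le_one (fun k _ => ?_) fun k _ => ?_ <;> split_ifs <;> norm_num

/-- The regret of one step: the failure probability of the confidence event plus the expected
observed widths. -/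
theorem IsRun.integral_step_le [IsProbabilityMeasure μ] (h : IsRun x z θ β γ n μ ℱ R A)
    (hK : 1 ≤ K) (hKL : K ≤ L)
    (hα : ∀ (S : Finset (Fin L)) (a : Fin L), a ∉ S →
      attraction x z θ β S a ∈ Set.Icc (0 : ℝ) 1)
    (hsub : IsSubmodular (fun S : Finset (Fin L) => ∑ j, θ j * coverage x S j))
    (hγ0 : 0 ≤ γ) {t : ℕ} (ht : t < n)
    (hγ : ∀ ω, (runStats x z R A t ω).Confident (Sum.elim θ β) n →
      √((runStats x z R A t ω).noise (Sum.elim θ β) ⬝ᵥ ((runStats x z R A t ω).gram⁻¹ *ᵥ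
        (runStats x z R A t ω).noise (Sum.elim θ β))) +
        √(Sum.elim θ β ⬝ᵥ Sum.elim θ β) ≤ γ) :
    ∫ ω, (eta K x z θ β * optimalReward K x z θ β - reward (R t ω) (A t ω)) ∂μ ≤
      1 / n + ∫ ω, min 1 (2 * γ * √(K * (runStats x z R A t ω).observedWidth x z (R t ω)
        (click (R t ω) (A t ω)))) ∂μ := by
  set v := eta K x z θ β * optimalReward K x z θ β with hv
  have hle : ℱ t ≤ mΩ := ℱ.le t
  have hstats := h.finMeas_runStats ht.le
  have hlist := h.finMeas_list ht
  -- The expected reward and the expected truncated widths, given the displayed list.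
  have h1 := h.integral_feedback ht (G := fun _ b =>
    v - (1 - ∏ k, (1 - if b k = true then (1 : ℝ) else 0))) (FinMeas.const _)
  have hWm : FinMeas (ℱ t) fun ω (b : Fin K → Bool) => min 1 (2 * γ *
      √(K * (runStats x z R A t ω).observedWidth x z (R t ω) (firstTrue b))) :=
    (hstats.prodMk hlist).comp fun y (b : Fin K → Bool) => min 1 (2 * γ *
      √(K * y.1.observedWidth x z y.2 (firstTrue b)))
  have h2 := h.integral_feedback ht hWm
  have hbad : MeasurableSet {ω | ¬ (runStats x z R A t ω).Confident (Sum.elim θ β) n} :=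
    hle _ (hstats.measurableSet fun s => ¬ s.Confident (Sum.elim θ β) n)
  have hprob := h.measureReal_not_confident_le hα (by omega) ht.le
  rw [← integral_indicator_one hbad] at hprob
  simp only [reward_eq, click_eq_firstTrue]
  rw [h1, h2]
  refine le_trans ?_ (add_le_add_left hprob _)
  have hI2 : Integrable (fun ω => ∑ b, patternProb (listAttraction x z θ β (R t ω)) b *
      min 1 (2 * γ * √(K * (runStats x z R A t ω).observedWidth x z (R t ω)
        (firstTrue b)))) μ :=
    ((hWm.prodMk hlist).comp fun y =>
      ∑ b, patternProb (listAttraction x z θ β y.2) b * y.1 b).integrable hle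
  have hI3 : Integrable ({ω | ¬ (runStats x z R A t ω).Confident (Sum.elim θ β) n}.indicator
      (1 : Ω → ℝ)) μ := (integrable_const (1 : ℝ)).indicator hbad
  have hI1 : Integrable (fun ω => ∑ b, patternProb (listAttraction x z θ β (R t ω)) b *
      (v - (1 - ∏ k, (1 - if b k = true then (1 : ℝ) else 0)))) μ :=
    (hlist.comp fun r => ∑ b, patternProb (listAttraction x z θ β r) b *
      (v - (1 - ∏ k, (1 - if b k = true then (1 : ℝ) else 0)))).integrable hle
  rw [← integral_add hI3 hI2]
  refine integral_mono hI1 (hI3.add hI2) fun ω => ?_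
  have hp : ∀ k, listAttraction x z θ β (R t ω) k ∈ Set.Icc (0 : ℝ) 1 :=
    fun k => hα _ _ (notMem_above _ k)
  have hexp : ∑ b, patternProb (listAttraction x z θ β (R t ω)) b *
      (v - (1 - ∏ k, (1 - if b k = true then (1 : ℝ) else 0))) =
      v - expectedReward x z θ β (R t ω) := by
    have := sum_patternProb_mul_reward (listAttraction x z θ β (R t ω))
    simp only [mul_sub _ v, Finset.sum_sub_distrib, this, ← Finset.sum_mul, sum_patternProb,
      one_mul]
    rfl
  simp only
  rw [hexp]
  have hV := Stats.gram_atTime_posDef x z (fun s => R s ω) (fun s => click (R s ω) (A s ω)) t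
  by_cases hc : (runStats x z R A t ω).Confident (Sum.elim θ β) n
  · rw [Set.indicator_of_notMem (by simpa using hc), zero_add]
    refine (eta_mul_optimalReward_sub_le hK hα hsub (R t ω) _ fun k a ha =>
      attraction_sub_le_of_isChoice (Stats.gram_atTime_sub_one_posSemidef x z (fun s => R s ω)
        (fun s => click (R s ω) (A s ω)) t) (hγ ω hc) (h.choice t ht ω) k ha).trans ?_
    refine Finset.sum_le_sum fun b _ =>
      mul_le_mul_of_nonneg_left (min_le_min_left _ ?_) (patternProb_nonneg hp b)
    exact sum_sqrt_width_le hV hγ0 (R t ω) (firstTrue b)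
  · rw [Set.indicator_of_mem (by simpa using hc)]
    have h3 := eta_mul_optimalReward_le_one (x := x) (z := z) hK hKL hα hsub
    have h4 := (expectedReward_mem_Icc hα (R t ω)).1
    have h5 : 0 ≤ ∑ b, patternProb (listAttraction x z θ β (R t ω)) b *
        min 1 (2 * γ * √(K * (runStats x z R A t ω).observedWidth x z (R t ω)
          (firstTrue b))) :=
      Finset.sum_nonneg fun b _ => mul_nonneg (patternProb_nonneg hp b)
        (le_min zero_le_one (by positivity))
    simp only [Pi.one_apply]
    linarith

theorem IsRun.scaledRegret_le_nat [IsProbabilityMeasure μ] (h : IsRun x z θ β γ n μ ℱ R A)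
    (hK : 1 ≤ K) (hKL : K ≤ L)
    (hα : ∀ (S : Finset (Fin L)) (a : Fin L), a ∉ S →
      attraction x z θ β S a ∈ Set.Icc (0 : ℝ) 1)
    (hsub : IsSubmodular (fun S : Finset (Fin L) => ∑ j, θ j * coverage x S j)) :
    scaledRegret x z θ β n μ R A ≤ n := by
  have h1 : ∀ t ∈ Finset.range n,
      ∫ ω, (eta K x z θ β * optimalReward K x z θ β - reward (R t ω) (A t ω)) ∂μ ≤ 1 := by
    intro t ht
    have hI := (((h.finMeas_reward (Finset.mem_range.1 ht)).comp fun r =>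
      eta K x z θ β * optimalReward K x z θ β - r).integrable (μ := μ) (ℱ.le (t + 1)))
    refine (integral_mono hI (integrable_const (1 : ℝ)) fun ω => ?_).trans (by simp)
    have := reward_nonneg (R t ω) (A t ω)
    have := eta_mul_optimalReward_le_one (x := x) (z := z) hK hKL hα hsub
    simp only
    linarith
  simpa [scaledRegret] using Finset.sum_le_sum h1

theorem gammaMin_nonneg (K n : ℕ) (θ : Fin d → ℝ) (β : Fin m → ℝ) :
    0 ≤ gammaMin K n θ β :=
  add_nonneg (Real.sqrt_nonneg _) (norm_nonneg _)

/-- The regret bound in positive dimension. -/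
theorem IsRun.scaledRegret_le [IsProbabilityMeasure μ] (h : IsRun x z θ β γ n μ ℱ R A)
    (hK : 1 ≤ K) (hKL : K ≤ L)
    (hx : ∀ a j, x a j ∈ Set.Icc (0 : ℝ) 1)
    (hz : ∀ a, ‖(WithLp.toLp 2 (z a) : EuclideanSpace ℝ (Fin m))‖ ≤ 1)
    (hα : ∀ (S : Finset (Fin L)) (a : Fin L), a ∉ S →
      attraction x z θ β S a ∈ Set.Icc (0 : ℝ) 1)
    (hsub : IsSubmodular (fun S : Finset (Fin L) => ∑ j, θ j * coverage x S j))
    (hγ : gammaMin K n θ β ≤ γ) (hn : 1 ≤ n) (hD : (1 : ℝ) ≤ (m : ℝ) + d) :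
    scaledRegret x z θ β n μ R A ≤
      2 * γ * √(2 * n * K * ((m : ℝ) + d) *
        Real.log (1 + (n : ℝ) * K / ((m : ℝ) + d))) + 1 := by
  have hn' : (1 : ℝ) ≤ n := by exact_mod_cast hn
  have hK' : (1 : ℝ) ≤ K := by exact_mod_cast hK
  set D := (m : ℝ) + d with hDdef
  set l := D * Real.log (1 + (n : ℝ) * K / D) with hl
  have hq0 : 0 < (n : ℝ) * K / D := by positivity
  have hl0 : 0 < l := mul_pos (by linarith) (Real.log_pos (by linarith))
  have hlogn : 0 ≤ Real.log n := Real.log_nonneg hn'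
  -- If the bound is at least `n` there is nothing to prove; otherwise `n` is large.
  rcases le_or_gt (n : ℝ) (2 * γ * √(2 * n * K * D * Real.log (1 + (n : ℝ) * K / D)) + 1)
    with htriv | hlt
  · exact (h.scaledRegret_le_nat hK hKL hα hsub).trans htriv
  have hw0 := Real.sqrt_nonneg (Sum.elim θ β ⬝ᵥ Sum.elim θ β)
  have hγ' : √(l + 2 * Real.log n) + √(Sum.elim θ β ⬝ᵥ Sum.elim θ β) ≤ γ := by
    rw [← paramNorm_eq]
    exact hγ
  have hγl : √l ≤ γ := by
    have : √l ≤ √(l + 2 * Real.log n) := Real.sqrt_le_sqrt (by linarith)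
    linarith
  have hγ0 : 0 < γ := lt_of_lt_of_le (Real.sqrt_pos.2 hl0) hγl
  have hnum := log_det_bound_of_nontrivial hD hK' hn' hγl (by linarith)
  have hdet : ∀ ω, ∀ t ≤ n, (1 + 1 / (8 * γ ^ 2 * K)) *
      Real.log (runStats x z R A t ω).gram.det ≤ 2 * l := by
    intro ω t ht
    refine le_trans (mul_le_mul_of_nonneg_left ?_ (by positivity)) hnum
    exact log_det_gram_atTime_le hx hz _ _ ht hD
  have hconf : ∀ t ≤ n, ∀ ω, (runStats x z R A t ω).Confident (Sum.elim θ β) n →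
      √((runStats x z R A t ω).noise (Sum.elim θ β) ⬝ᵥ ((runStats x z R A t ω).gram⁻¹ *ᵥ
        (runStats x z R A t ω).noise (Sum.elim θ β))) +
        √(Sum.elim θ β ⬝ᵥ Sum.elim θ β) ≤ γ := by
    intro t ht ω hc
    refine le_trans (add_le_add_left (Real.sqrt_le_sqrt ?_) _) hγ'
    have h1 : Real.log (runStats x z R A t ω).gram.det ≤ 2 * l := by
      rcases le_total (Real.log (runStats x z R A t ω).gram.det) 0 with h0 | h0
      · linarith
      · refine le_trans ?_ (hdet ω t ht)
        exact le_mul_of_one_le_left h0 (le_add_of_nonneg_right (by positivity))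
    rw [Stats.Confident] at hc
    linarith
  have hstep : ∀ t ∈ Finset.range n, _ := fun t ht =>
    h.integral_step_le hK hKL hα hsub hγ0.le (Finset.mem_range.1 ht)
      (hconf t (Finset.mem_range.1 ht).le)
  have hint : ∀ t ∈ Finset.range n, Integrable (fun ω => min 1 (2 * γ *
      √(K * (runStats x z R A t ω).observedWidth x z (R t ω) (click (R t ω) (A t ω))))) μ := by
    intro t ht
    have ht := Finset.mem_range.1 ht
    have hs := (h.finMeas_runStats ht.le).mono (ℱ.mono t.le_succ)
    have hr := (h.finMeas_list ht).mono (ℱ.mono t.le_succ)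
    exact (((hs.prodMk hr).prodMk (h.finMeas_pattern ht)).comp fun y => min 1 (2 * γ *
      √(K * y.1.1.observedWidth x z y.1.2 (firstTrue y.2)))).integrable (ℱ.le (t + 1))
  refine (Finset.sum_le_sum hstep).trans ?_
  rw [Finset.sum_add_distrib, ← integral_finsetSum _ hint]
  have hone : ∑ _t ∈ Finset.range n, 1 / (n : ℝ) = 1 := by
    rw [Finset.sum_const, Finset.card_range, nsmul_eq_mul]
    field_simp
  rw [hone, add_comm]
  refine add_le_add_left ?_ _
  refine (integral_mono (integrable_finsetSum _ hint) (integrable_const _) fun ω =>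
    sum_min_one_le (R := fun s => R s ω) (c := fun s => click (R s ω) (A s ω)) hγ0 hK
      (hdet ω n le_rfl)).trans ?_
  rw [integral_const, probReal_univ, one_smul, hl, ← mul_assoc]

/-- Without features all attraction probabilities vanish, and so does the optimal reward. -/
theorem scaledRegret_nonpos_of_dim_zero (x : Fin L → Fin 0 → ℝ) (z : Fin L → Fin 0 → ℝ)
    (θ : Fin 0 → ℝ) (β : Fin 0 → ℝ) (R : ℕ → Ω → Fin K ↪ Fin L) (A : ℕ → Ω → Fin L → Bool) :
    scaledRegret x z θ β n μ R A ≤ 0 := by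
  have h0 : optimalReward K x z θ β = 0 := by
    simp [optimalReward, expectedReward, attraction]
  refine Finset.sum_nonpos fun t _ => integral_nonpos fun ω => ?_
  simp only [h0, mul_zero, zero_sub, Pi.zero_apply, Left.neg_nonpos_iff]
  exact reward_nonneg _ _

end Regret

end CascadeHybrid

theorem theorem1 :
    ∃ C : ℝ, ∀ (L K m d n : ℕ), 1 ≤ K → K ≤ L →
      ∀ (x : Fin L → Fin d → ℝ) (z : Fin L → Fin m → ℝ) (θ : Fin d → ℝ) (β : Fin m → ℝ),
      (∀ a j, x a j ∈ Set.Icc (0 : ℝ) 1) →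
      (∀ a, ‖(WithLp.toLp 2 (z a) : EuclideanSpace ℝ (Fin m))‖ ≤ 1) →
      CascadeHybrid.IsSubmodular (fun S => ∑ j, θ j * CascadeHybrid.coverage x S j) →
      (∀ (S : Finset (Fin L)) (a : Fin L), a ∉ S →
        CascadeHybrid.attraction x z θ β S a ∈ Set.Icc (0 : ℝ) 1) →
      CascadeHybrid.paramNorm θ β ≤ 1 →
      ∀ γ : ℝ, CascadeHybrid.gammaMin K n θ β ≤ γ →
      ∀ (Ω : Type*) [mΩ : MeasurableSpace Ω] (μ : Measure Ω) [IsProbabilityMeasure μ]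
        (ℱ : Filtration ℕ mΩ) (R : ℕ → Ω → Fin K ↪ Fin L) (A : ℕ → Ω → Fin L → Bool),
      CascadeHybrid.IsRun x z θ β γ n μ ℱ R A →
        CascadeHybrid.scaledRegret x z θ β n μ R A ≤
            2 * γ * √(2 * n * K * ((m : ℝ) + d) *
              Real.log (1 + (n : ℝ) * K / ((m : ℝ) + d))) + 1 ∧
        (γ = CascadeHybrid.gammaMin K n θ β →
          CascadeHybrid.scaledRegret x z θ β n μ R A ≤
            C * (((m : ℝ) + d) * √((K : ℝ) * n) * Real.log (1 + (n : ℝ) * K))) := by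
  refine ⟨12, ?_⟩
  intro L K m d n hK hKL x z θ β hx hz hsub hα hw γ hγ Ω mΩ μ hμ ℱ R A h
  have hγ0 : 0 ≤ γ := (CascadeHybrid.gammaMin_nonneg K n θ β).trans hγ
  rcases Nat.eq_zero_or_pos n with rfl | hn
  · have h0 : CascadeHybrid.scaledRegret x z θ β 0 μ R A = 0 := by
      simp [CascadeHybrid.scaledRegret]
    rw [h0]
    exact ⟨by positivity, fun _ => by simp⟩
  rcases Nat.eq_zero_or_pos (m + d) with hmd | hmd
  · obtain ⟨rfl, rfl⟩ : m = 0 ∧ d = 0 := by omega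
    have h0 := CascadeHybrid.scaledRegret_nonpos_of_dim_zero (n := n) (μ := μ) x z θ β R A
    exact ⟨h0.trans (by positivity), fun _ => h0.trans (by simp)⟩
  have hD : (1 : ℝ) ≤ (m : ℝ) + d := by exact_mod_cast hmd
  have h1 := h.scaledRegret_le hK hKL hx hz hα hsub hγ hn hD
  refine ⟨h1, fun hγeq => h1.trans ?_⟩
  rw [hγeq]
  exact CascadeHybrid.regret_bound_le_order hD (by exact_mod_cast hK) (by exact_mod_cast hn) hw
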